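/- Let $(f(p))_{p\text{ prime}}$ be independent random variables with $\mathbb{P}(f(p)=1)=\mathbb{P}(f(p)=-1)=1/2$, and extend $f$ to the positive integers by multiplicativity with support on the squarefree integers, i.e. $f(n)=\prod_{p\mid n}f(p)$ if $n$ is squarefree and $f(n)=0$ otherwise ($f$ is called a Rademacher random multiplicative function). Put $\mathcal M(x)=\sum_{n\le x}f(n)$ for real $x\geq 1$. (1) Let $\lambda:[1,\infty)\to\mathbb{R}$ be any function such that $\int_1^\infty \frac{|\lambda(u)|}{u^{3/2}}\,du<\infty$. Then, almost surely, $\mathcal M(x)+\lambda(x)$ changes sign infinitely often as $x\to\infty$; that is, neither of the inequalities $\mathcal M(x)+\lambda(x)\ge 0$ and $\mathcal M(x)+\lambda(x)\le 0$ holds for all sufficiently large real $x$. (2) As a consequence, almost surely, $$\mathcal M(x)=\Omega_\pm\left(\frac{\sqrt x}{(\log x)(\log\log x)^2}\right)\quad (x\to\infty);$$ that is, with $g(x)=\frac{\sqrt x}{(\log x)(\log\log x)^2}$, almost surely $\limsup_{x\to\infty}\mathcal M(x)/g(x)>0$ and $\liminf_{x\to\infty}\mathcal M(x)/g(x)<0$.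 -/

import Mathlib

open MeasureTheory ProbabilityTheory Filter

/-- `f` is a Rademacher random multiplicative function on the probability space `(Ω, μ)`:
the values `f p` at the primes are independent and equal to `1` or `-1` with probability `1/2`
each, and `f` is extended to all positive integers by multiplicativity, with support on the
squarefree integers. (In particular `f 0 = 0`, a value that never enters below.) -/
structure IsRademacherRMF {Ω : Type*} [MeasurableSpace Ω] (μ : Measure Ω)
    (f : ℕ → Ω → ℝ) : Prop where
  measurable_prime : ∀ p : ℕ, p.Prime → Measurable (f p)
  prob_one : ∀ p : ℕ, p.Prime → μ {ω | f p ω = 1} = 1 / 2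
  prob_neg_one : ∀ p : ℕ, p.Prime → μ {ω | f p ω = -1} = 1 / 2
  indep : iIndepFun (fun p : Nat.Primes => f (p : ℕ)) μ
  map_one : ∀ ω, f 1 ω = 1
  map_mul : ∀ m n : ℕ, Nat.Coprime m n → ∀ ω, f (m * n) ω = f m ω * f n ω
  map_not_squarefree : ∀ n : ℕ, ¬ Squarefree n → ∀ ω, f n ω = 0

/-- The partial sum `∑_{n ≤ x} f(n)` over the positive integers `n ≤ x`, at the outcome `ω`. -/
noncomputable def partialSum {Ω : Type*} (f : ℕ → Ω → ℝ) (ω : Ω) (x : ℝ) : ℝ :=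
  ∑ n ∈ Finset.Icc 1 ⌊x⌋₊, f n ω

/-- `g` changes its sign infinitely often as `x → ∞`: neither `g x ≥ 0` nor `g x ≤ 0` holds for
all sufficiently large real `x`. -/
def ChangesSignInfinitelyOften (g : ℝ → ℝ) : Prop :=
  (¬ ∀ᶠ x in atTop, 0 ≤ g x) ∧ (¬ ∀ᶠ x in atTop, g x ≤ 0)

/-- `F = Ω_±(g)` as `x → ∞`, for an eventually positive `g`: there are positive constants `c`
with `F x > c * g x`, respectively `F x < -c * g x`, for arbitrarily large `x`
(that is, `limsup F / g > 0` and `liminf F / g < 0`). -/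
def IsOmegaPlusMinus (F g : ℝ → ℝ) : Prop :=
  (∃ c : ℝ, 0 < c ∧ ∃ᶠ x in atTop, c * g x < F x) ∧
    (∃ c : ℝ, 0 < c ∧ ∃ᶠ x in atTop, F x < -c * g x)

/-! The argument compares the random Euler product `F(s) = ∏ (1 + f(p) p^{-s})`, cut off at `p ≤ N`,
at the points `σ` and `σ + i` as `σ` approaches `1/2` from the right. Abel summation identifies
`F(s)` with `s ∫ M(t) t^{-s-1} dt` over `1 < t ≤ N`, up to an error that is small in mean square
once `N` is large in terms of `σ`, because the `f(n)` with `n` squarefree are orthonormal.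

Suppose `M + λ` is eventually of one sign. Then `|M| ≤ ±M + 2|λ|` eventually, and since `t^{-σ-1} ≤
t^{-3/2}` the integral of `|M| t^{-σ-1}` is at most `|∫ M t^{-σ-1}| + B` with `B` independent of `σ`
and `N`. As `|t^{-i}| = 1`, boundedness of `F(σ)` therefore forces boundedness of `F(σ + i)`.

Almost surely this fails. On the real axis `E √|F(σ)| ≤ exp(-∑ p^{-2σ} / 8)`, so `F(σ) → 0` along a
suitable sequence. At `s = σ + i`, `log |F(s)|` is `log |∏ (1 - p^{-2s})| / 2` plus a weighted sum
of the signs `f(p)`. The first term stays bounded because `ζ(1 + 2i)` is finite and nonzero, while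
the variance of the second tends to infinity. A moment inequality shows that the sum exceeds any
level with probability at least `1/28`, and the zero-one law turns this into almost sure
unboundedness.

The second claim follows by taking `λ = ∓g` for large `x`; this is admissible because `1 / (x log x
(log log x)²)` is the derivative of `-1 / log log x`. -/

/-- A family of independent symmetric signs. -/
structure IsRademacherFamily {ι Ω : Type*} [MeasurableSpace Ω] (ε : ι → Ω → ℝ)
    (μ : Measure Ω) : Prop where
  measurable : ∀ i, Measurable (ε i)
  sq_eq_one : ∀ i, ∀ᵐ ω ∂μ, ε i ω ^ 2 = 1
  integral_eq_zero : ∀ i, ∫ ω, ε i ω ∂μ = 0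
  indep : iIndepFun ε μ

/-! ### Weighted sums of independent signs: moments and almost sure unboundedness -/

namespace IsRademacherFamily

variable {ι Ω : Type*} [MeasurableSpace Ω] {ε : ι → Ω → ℝ} {μ : Measure Ω}

lemma measurable_sum (h : IsRademacherFamily ε μ) (J : Finset ι) (b : ι → ℝ) :
    Measurable (fun ω => ∑ i ∈ J, b i * ε i ω) :=
  Finset.measurable_fun_sum _ fun i _ => (h.measurable i).const_mul _

lemma ae_abs_eq_one (h : IsRademacherFamily ε μ) (i : ι) : ∀ᵐ ω ∂μ, |ε i ω| = 1 := by
  filter_upwards [h.sq_eq_one i] with ω hω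
  rwa [← sq_abs, pow_eq_one_iff_of_nonneg (abs_nonneg _) two_ne_zero] at hω

lemma ae_abs_sum_le (h : IsRademacherFamily ε μ) (J : Finset ι) (b : ι → ℝ) :
    ∀ᵐ ω ∂μ, |∑ i ∈ J, b i * ε i ω| ≤ ∑ i ∈ J, |b i| := by
  have : ∀ᵐ ω ∂μ, ∀ i ∈ J, |ε i ω| = 1 :=
    (ae_ball_iff J.countable_toSet).2 fun i _ => h.ae_abs_eq_one i
  filter_upwards [this] with ω hω
  refine (Finset.abs_sum_le_sum_abs _ _).trans (Finset.sum_le_sum fun i hi => ?_)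
  rw [abs_mul, hω i hi, mul_one]

lemma integrable_sum_pow_mul [IsFiniteMeasure μ] (h : IsRademacherFamily ε μ) (J : Finset ι)
    (b : ι → ℝ) (n m : ℕ) (i : ι) :
    Integrable (fun ω => (∑ j ∈ J, b j * ε j ω) ^ n * ε i ω ^ m) μ := by
  refine Integrable.of_bound
    (((h.measurable_sum J b).pow_const n).mul ((h.measurable i).pow_const m)).aestronglyMeasurable
    ((∑ j ∈ J, |b j|) ^ n) ?_
  filter_upwards [h.ae_abs_sum_le J b, h.ae_abs_eq_one i] with ω h1 h2
  rw [Real.norm_eq_abs, abs_mul, abs_pow, abs_pow, h2, one_pow, mul_one]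
  gcongr

lemma integrable_sum_pow [IsFiniteMeasure μ] (h : IsRademacherFamily ε μ) (J : Finset ι)
    (b : ι → ℝ) (n : ℕ) : Integrable (fun ω => (∑ j ∈ J, b j * ε j ω) ^ n) μ := by
  refine Integrable.of_bound ((h.measurable_sum J b).pow_const n).aestronglyMeasurable
    ((∑ j ∈ J, |b j|) ^ n) ?_
  filter_upwards [h.ae_abs_sum_le J b] with ω h1
  rw [Real.norm_eq_abs, abs_pow]
  gcongr

lemma integral_sum_pow_mul_eq_zero (h : IsRademacherFamily ε μ) (J : Finset ι)
    (b : ι → ℝ) (n : ℕ) {i : ι} (hi : i ∉ J) :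
    ∫ ω, (∑ j ∈ J, b j * ε j ω) ^ n * ε i ω ∂μ = 0 := by
  classical
  have h1 : IndepFun (fun ω (j : J) => ε j ω) (fun ω (j : ({i} : Finset ι)) => ε j ω) μ :=
    h.indep.indepFun_finset J {i} (by simpa using hi) h.measurable
  have hψ : Measurable fun x : ({i} : Finset ι) → ℝ => x ⟨i, Finset.mem_singleton_self i⟩ :=
    measurable_pi_apply _
  have h2 := h1.comp (φ := fun x : J → ℝ => (∑ j : J, b j * x j) ^ n)
    (ψ := fun x : ({i} : Finset ι) → ℝ => x ⟨i, Finset.mem_singleton_self i⟩)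
    ((Finset.measurable_fun_sum _ fun j _ =>
      (measurable_pi_apply j).const_mul _).pow_const n) hψ
  have h3 : IndepFun (fun ω => (∑ j ∈ J, b j * ε j ω) ^ n) (ε i) μ := by
    convert! h2 using 1
    ext ω
    simp only [Function.comp]
    rw [Finset.sum_coe_sort J (fun j => b j * ε j ω)]
  rw [h3.integral_fun_mul_eq_mul_integral
    ((h.measurable_sum J b).pow_const n).aestronglyMeasurable
    (h.measurable i).aestronglyMeasurable, h.integral_eq_zero, mul_zero]

lemma integral_sum_eq_zero [IsFiniteMeasure μ] (h : IsRademacherFamily ε μ) (J : Finset ι)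
    (b : ι → ℝ) : ∫ ω, ∑ j ∈ J, b j * ε j ω ∂μ = 0 := by
  rw [integral_finsetSum]
  · simp [integral_const_mul, h.integral_eq_zero]
  · intro i _
    simpa using (h.integrable_sum_pow {i} b 1)

lemma integral_sum_sq [IsProbabilityMeasure μ] (h : IsRademacherFamily ε μ) (J : Finset ι)
    (b : ι → ℝ) : ∫ ω, (∑ j ∈ J, b j * ε j ω) ^ 2 ∂μ = ∑ j ∈ J, b j ^ 2 := by
  classical
  induction J using Finset.induction_on with
  | empty => simp
  | insert i J hi ih =>
    rw [Finset.sum_insert hi, ← ih]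
    have : ∀ᵐ ω ∂μ, (∑ j ∈ insert i J, b j * ε j ω) ^ 2 =
        b i ^ 2 + (∑ j ∈ J, b j * ε j ω) ^ 2 +
          (2 * b i) * ((∑ j ∈ J, b j * ε j ω) ^ 1 * ε i ω ^ 1) := by
      filter_upwards [h.sq_eq_one i] with ω hω
      rw [Finset.sum_insert hi]
      linear_combination b i ^ 2 * hω
    have i2 := h.integrable_sum_pow J b 2
    have i1 := (h.integrable_sum_pow_mul J b 1 1 i).const_mul (2 * b i)
    rw [integral_congr_ae this, integral_add ((integrable_const _).fun_add i2) i1,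
      integral_add (integrable_const _) i2, integral_const_mul]
    have := h.integral_sum_pow_mul_eq_zero J b 1 hi
    simp only [pow_one] at this ⊢
    simp [this]

/-- Adding one sign and expanding, the terms odd in the new sign have mean zero. What remains is `b⁴
+ 6 b² V + E S⁴`, which is at most `3 (b² + V)²` by induction. -/
lemma integral_sum_pow_four_le [IsProbabilityMeasure μ] (h : IsRademacherFamily ε μ)
    (J : Finset ι) (b : ι → ℝ) :
    ∫ ω, (∑ j ∈ J, b j * ε j ω) ^ 4 ∂μ ≤ 3 * (∑ j ∈ J, b j ^ 2) ^ 2 := by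
  classical
  induction J using Finset.induction_on with
  | empty => simp
  | insert i J hi ih =>
    rw [Finset.sum_insert hi]
    have : ∀ᵐ ω ∂μ, (∑ j ∈ insert i J, b j * ε j ω) ^ 4 =
        b i ^ 4 + (∑ j ∈ J, b j * ε j ω) ^ 4 + 6 * b i ^ 2 * (∑ j ∈ J, b j * ε j ω) ^ 2 +
          (4 * b i) * ((∑ j ∈ J, b j * ε j ω) ^ 3 * ε i ω ^ 1) +
          (4 * b i ^ 3) * ((∑ j ∈ J, b j * ε j ω) ^ 1 * ε i ω ^ 1) := by
      filter_upwards [h.sq_eq_one i] with ω hω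
      rw [Finset.sum_insert hi]
      set S := ∑ j ∈ J, b j * ε j ω
      linear_combination (b i ^ 4 * (ε i ω ^ 2 + 1) + 4 * b i ^ 3 * S * ε i ω +
        6 * b i ^ 2 * S ^ 2) * hω
    have i4 := h.integrable_sum_pow J b 4
    have i2 := (h.integrable_sum_pow J b 2).const_mul (6 * b i ^ 2)
    have i3 := (h.integrable_sum_pow_mul J b 3 1 i).const_mul (4 * b i)
    have i1 := (h.integrable_sum_pow_mul J b 1 1 i).const_mul (4 * b i ^ 3)
    have i0 : Integrable (fun _ : Ω => b i ^ 4) μ := integrable_const _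
    rw [integral_congr_ae this, integral_add (((i0.fun_add i4).fun_add i2).fun_add i3) i1,
      integral_add ((i0.fun_add i4).fun_add i2) i3, integral_add (i0.fun_add i4) i2, integral_add i0 i4,
      integral_const_mul, integral_const_mul, integral_const_mul, h.integral_sum_sq]
    have e1 := h.integral_sum_pow_mul_eq_zero J b 1 hi
    have e3 := h.integral_sum_pow_mul_eq_zero J b 3 hi
    simp only [pow_one] at e1 e3 ⊢
    rw [e1, e3]
    simp only [integral_const, probReal_univ, one_smul, mul_zero, add_zero]
    nlinarith [sq_nonneg (b i ^ 2)]

/-- A Rademacher sum exceeds a quarter of its standard deviation with probability `≥ 1 / 28`. -/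
lemma measureReal_sum_gt_ge [IsProbabilityMeasure μ] (h : IsRademacherFamily ε μ)
    (J : Finset ι) (b : ι → ℝ) {K : ℝ} (hK : 0 < K) (hV : (4 * K) ^ 2 ≤ ∑ j ∈ J, b j ^ 2) :
    1 / 28 ≤ μ.real {ω | K < ∑ j ∈ J, b j * ε j ω} := by
  set V := ∑ j ∈ J, b j ^ 2 with hVdef
  have hVpos : 0 < V := lt_of_lt_of_le (by positivity) hV
  obtain ⟨r, hr, hrV⟩ : ∃ r : ℝ, 0 < r ∧ r ^ 2 = V :=
    ⟨√V, Real.sqrt_pos.2 hVpos, Real.sq_sqrt hVpos.le⟩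
  have hKr : 4 * K ≤ r := by
    rw [← hrV] at hV
    exact le_of_sq_le_sq hV hr.le
  set S : Ω → ℝ := fun ω => ∑ j ∈ J, b j * ε j ω with hS
  set A := {ω | K < S ω} with hA
  have hAm : MeasurableSet A := measurableSet_lt measurable_const (h.measurable_sum J b)
  -- The quartic is at most `7` everywhere and at most `0` for `u ≤ 1/4`; the coefficients are such
  -- that `u⁴ - 12u² - 16u = u (u + 2)² (u - 4)`. For a variable with mean `0`, variance `1` and
  -- fourth moment at most `3`, its expectation is at least `1 - 1/4 - 1/2 = 1/4`, whence the
  -- probability `(1/4) / 7 = 1/28`.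
  have key : ∀ u : ℝ, 4 / 3 * u + u ^ 2 - u ^ 4 / 12 - 1 / 2 ≤ 7 := fun u => by
    nlinarith [sq_nonneg (u ^ 2 - 8), sq_nonneg (u - 2)]
  have key' : ∀ u : ℝ, u ≤ 1 / 4 → 4 / 3 * u + u ^ 2 - u ^ 4 / 12 - 1 / 2 ≤ 0 := fun u hu => by
    rcases le_total u 0 with h0 | h0
    · have : 0 ≤ (-u) * ((u + 2) ^ 2 * (4 - u)) := by
        have : 0 ≤ 4 - u := by linarith
        have : 0 ≤ -u := by linarith
        positivity
      nlinarith
    · nlinarith [sq_nonneg (u ^ 2)]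
  have hpt : ∀ ω, 4 / (3 * r) * S ω + S ω ^ 2 / V - S ω ^ 4 / (12 * V ^ 2) - 1 / 2 ≤
      A.indicator (fun _ => (7 : ℝ)) ω := fun ω => by
    have e : 4 / (3 * r) * S ω + S ω ^ 2 / V - S ω ^ 4 / (12 * V ^ 2) - 1 / 2 =
        4 / 3 * (S ω / r) + (S ω / r) ^ 2 - (S ω / r) ^ 4 / 12 - 1 / 2 := by
      rw [← hrV]; field_simp
    rw [e]
    by_cases hω : ω ∈ A
    · rw [Set.indicator_of_mem hω]; exact key _
    · rw [Set.indicator_of_notMem hω]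
      refine key' _ ?_
      rw [div_le_iff₀ hr]
      have : S ω ≤ K := not_lt.1 hω
      linarith
  have i1 : Integrable S μ := by simpa using h.integrable_sum_pow J b 1
  have i2 : Integrable (fun ω => S ω ^ 2) μ := h.integrable_sum_pow J b 2
  have i4 : Integrable (fun ω => S ω ^ 4) μ := h.integrable_sum_pow J b 4
  have hint := integral_mono
    ((((i1.const_mul (4 / (3 * r))).add (i2.div_const V)).sub (i4.div_const (12 * V ^ 2))).sub
      (integrable_const (1 / 2 : ℝ))) ((integrable_const (7 : ℝ)).indicator hAm) hpt
  rw [integral_sub' (((i1.const_mul _).add (i2.div_const _)).sub (i4.div_const _))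
    (integrable_const _), integral_sub' ((i1.const_mul _).add (i2.div_const _)) (i4.div_const _),
    integral_add' (i1.const_mul _) (i2.div_const _), integral_const_mul, integral_div,
    integral_div, integral_indicator_const _ hAm] at hint
  have e1 : ∫ ω, S ω ∂μ = 0 := h.integral_sum_eq_zero J b
  have e2 : ∫ ω, S ω ^ 2 ∂μ = V := h.integral_sum_sq J b
  have e4 : (∫ ω, S ω ^ 4 ∂μ) / (12 * V ^ 2) ≤ 1 / 4 := by
    rw [div_le_iff₀ (by positivity)]
    have : ∫ ω, S ω ^ 4 ∂μ ≤ 3 * V ^ 2 := h.integral_sum_pow_four_le J b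
    linarith
  rw [e1, e2, div_self hVpos.ne'] at hint
  simp only [integral_const, probReal_univ, smul_eq_mul, mul_zero, one_mul] at hint
  linarith

/-- Kolmogorov's zero-one law for the boundedness of weighted sums with bounded weights. -/
lemma measure_not_bddAbove_eq_zero_or_one (h : IsRademacherFamily ε μ)
    {b : ℕ → ι → ℝ} {J : ℕ → Finset ι} {C : ℝ} (hb : ∀ k i, |b k i| ≤ C) :
    μ {ω | ¬ BddAbove (Set.range fun k => ∑ i ∈ J k, b k i * ε i ω)} = 0 ∨
      μ {ω | ¬ BddAbove (Set.range fun k => ∑ i ∈ J k, b k i * ε i ω)} = 1 := by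
  classical
  refine measure_zero_or_one_of_measurableSet_limsup (ι := ι) (β := Finset ι)
    (s := fun i => MeasurableSpace.comap (ε i) inferInstance) (f := cofinite)
    (p := Set.Finite) (ns := fun s : Finset ι => (s : Set ι)) (fun i => (h.measurable i).comap_le)
    h.indep (fun t ht => by simpa using ht.compl_mem_cofinite) ?_
    (fun s => s.finite_toSet) (fun i => ⟨{i}, by simp⟩) ?_
  · exact fun s t => ⟨s ∪ t, by simp, by simp⟩
  rw [limsup_eq_iInf_iSup]
  simp only [MeasurableSpace.measurableSet_iInf]
  intro T hT
  set s : Finset ι := (mem_cofinite.1 hT).toFinset with hs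
  have hmem : ∀ i, i ∉ s → i ∈ T := fun i hi => by simpa [hs] using hi
  -- Dropping a finite set `s` of indices changes all the sums by an amount bounded uniformly in
  -- `k`, because the weights are bounded by `C`. Boundedness is thus a tail event, even though the
  -- weights vary with `k`.
  have hset : {ω | ¬ BddAbove (Set.range fun k => ∑ i ∈ J k, b k i * ε i ω)} =
      {ω | BddAbove (Set.range fun k => ∑ i ∈ J k \ s, b k i * ε i ω)}ᶜ := by
    ext ω
    simp only [Set.mem_ofPred_eq, Set.mem_compl_iff, not_iff_not]
    have hd : ∀ k, |∑ i ∈ J k, b k i * ε i ω - ∑ i ∈ J k \ s, b k i * ε i ω| ≤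
        ∑ i ∈ s, C * |ε i ω| := fun k => by
      have : ∑ i ∈ J k, b k i * ε i ω - ∑ i ∈ J k \ s, b k i * ε i ω =
          ∑ i ∈ J k ∩ s, b k i * ε i ω := by
        rw [← Finset.sum_inter_add_sum_sdiff (J k) s]; ring
      rw [this]
      refine (Finset.abs_sum_le_sum_abs _ _).trans ?_
      refine (Finset.sum_le_sum fun i _ => ?_).trans
        (Finset.sum_le_sum_of_subset_of_nonneg Finset.inter_subset_right fun i _ _ =>
          mul_nonneg ((abs_nonneg _).trans (hb 0 i)) (abs_nonneg _))
      rw [abs_mul]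
      exact mul_le_mul_of_nonneg_right (hb k i) (abs_nonneg _)
    constructor
    · rintro ⟨B, hB⟩
      refine ⟨B + ∑ i ∈ s, C * |ε i ω|, ?_⟩
      rintro _ ⟨k, rfl⟩
      have := hB ⟨k, rfl⟩
      have := abs_le.1 (hd k)
      dsimp only at *
      linarith
    · rintro ⟨B, hB⟩
      refine ⟨B + ∑ i ∈ s, C * |ε i ω|, ?_⟩
      rintro _ ⟨k, rfl⟩
      have := hB ⟨k, rfl⟩
      have := abs_le.1 (hd k)
      dsimp only at *
      linarith
  rw [hset]
  refine MeasurableSet.compl ?_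
  refine @measurableSet_bddAbove_range ℝ Ω _ _ _
    (⨆ a ∈ T, MeasurableSpace.comap (ε a) inferInstance) _ _ _ ℕ _ _ fun k => ?_
  refine @Finset.measurable_fun_sum ℝ ι Ω _ _ _
    (⨆ a ∈ T, MeasurableSpace.comap (ε a) inferInstance) _ _ fun i hi => ?_
  refine Measurable.const_mul (Measurable.of_comap_le ?_) _
  exact le_iSup₂_of_le i (hmem i (Finset.mem_sdiff.1 hi).2) le_rfl

/-- Weighted Rademacher sums with bounded weights and variances tending to infinity are almost
surely unbounded above. -/
theorem ae_not_bddAbove [IsProbabilityMeasure μ] (h : IsRademacherFamily ε μ)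
    {b : ℕ → ι → ℝ} {J : ℕ → Finset ι} {C : ℝ} (hb : ∀ k i, |b k i| ≤ C)
    (hV : Tendsto (fun k => ∑ i ∈ J k, b k i ^ 2) atTop atTop) :
    ∀ᵐ ω ∂μ, ¬ BddAbove (Set.range fun k => ∑ i ∈ J k, b k i * ε i ω) := by
  set S : ℕ → Ω → ℝ := fun k ω => ∑ i ∈ J k, b k i * ε i ω with hS
  have hSm : ∀ k, Measurable (S k) := fun k => h.measurable_sum _ _
  have hm : MeasurableSet {ω | ¬ BddAbove (Set.range fun k => S k ω)} :=
    (measurableSet_bddAbove_range hSm).compl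
  -- The levels are `n + 1` because the moment inequality needs a positive level.
  have hset : {ω | ¬ BddAbove (Set.range fun k => S k ω)} =
      ⋂ n : ℕ, ⋃ k, {ω | (n : ℝ) + 1 < S k ω} := by
    ext ω
    simp only [Set.mem_ofPred_eq, not_bddAbove_iff, Set.mem_range, exists_exists_eq_and,
      Set.mem_iInter, Set.mem_iUnion]
    refine ⟨fun H n => H _, fun H x => ?_⟩
    obtain ⟨n, hn⟩ := exists_nat_gt x
    obtain ⟨k, hk⟩ := H n
    exact ⟨k, by linarith⟩
  have hpos : (ENNReal.ofReal (1 / 28)) ≤ μ {ω | ¬ BddAbove (Set.range fun k => S k ω)} := by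
    rw [hset]
    have hanti : Antitone fun n : ℕ => ⋃ k, {ω | (n : ℝ) + 1 < S k ω} := by
      intro m n hmn
      refine Set.iUnion_mono fun k ω (hω : (n : ℝ) + 1 < S k ω) => ?_
      have : (m : ℝ) ≤ n := by exact_mod_cast hmn
      simp only [Set.mem_ofPred_eq]
      linarith
    rw [hanti.measure_iInter (fun n => (MeasurableSet.iUnion fun k =>
      measurableSet_lt measurable_const (hSm k)).nullMeasurableSet) ⟨0, measure_ne_top _ _⟩]
    refine le_iInf fun n => ?_
    obtain ⟨k, hk⟩ := (hV.eventually_ge_atTop ((4 * ((n : ℝ) + 1)) ^ 2)).exists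
    have := h.measureReal_sum_gt_ge (J k) (b k) (K := (n : ℝ) + 1) (by positivity) hk
    refine le_trans ?_ (measure_mono (Set.subset_iUnion _ k))
    exact (ENNReal.ofReal_le_iff_le_toReal (measure_ne_top _ _)).2 this
  have h1 : μ {ω | ¬ BddAbove (Set.range fun k => S k ω)} = 1 := by
    refine (h.measure_not_bddAbove_eq_zero_or_one (J := J) hb).resolve_left fun h0 => ?_
    rw [h0] at hpos
    norm_num at hpos
  exact (mem_ae_iff_prob_eq_one hm).2 h1

end IsRademacherFamily

/-! ### Products of independent signs: orthogonality and half-moments -/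

namespace IsRademacherFamily

variable {ι Ω : Type*} [MeasurableSpace Ω] {ε : ι → Ω → ℝ} {μ : Measure Ω}

lemma integral_prod_comp (h : IsRademacherFamily ε μ) (J : Finset ι) {φ : ι → ℝ → ℝ}
    (hφ : ∀ i, Measurable (φ i)) :
    ∫ ω, ∏ i ∈ J, φ i (ε i ω) ∂μ = ∏ i ∈ J, ∫ ω, φ i (ε i ω) ∂μ := by
  have h1 : iIndepFun (fun (i : J) => ε i) μ :=
    h.indep.precomp (g := fun i : J => (i : ι)) Subtype.val_injective
  have := h1.integral_fun_prod_comp (f := fun i : J => φ i)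
    (fun i => (h.measurable i).aemeasurable) (fun i => (hφ i).aestronglyMeasurable)
  rw [← Finset.prod_coe_sort J (fun i => ∫ ω, φ i (ε i ω) ∂μ), ← this]
  congr 1
  ext ω
  exact (Finset.prod_coe_sort J (fun i => φ i (ε i ω))).symm

lemma integral_prod_mul_prod [IsProbabilityMeasure μ] [DecidableEq ι]
    (h : IsRademacherFamily ε μ) (J K : Finset ι) :
    ∫ ω, (∏ i ∈ J, ε i ω) * ∏ i ∈ K, ε i ω ∂μ = if J = K then 1 else 0 := by
  -- Factor by factor over `J ∪ K`: an index in both sets contributes `ε² = 1`, an index in exactly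
  -- one contributes `ε`, of mean zero.
  let φ : ι → ℝ → ℝ := fun i x => (if i ∈ J then x else 1) * (if i ∈ K then x else 1)
  have hφ : ∀ i, Measurable (φ i) := fun i =>
    (by split_ifs <;> fun_prop : Measurable fun x : ℝ => if i ∈ J then x else 1).mul
      (by split_ifs <;> fun_prop : Measurable fun x : ℝ => if i ∈ K then x else 1)
  have e : ∀ ω, (∏ i ∈ J, ε i ω) * ∏ i ∈ K, ε i ω = ∏ i ∈ J ∪ K, φ i (ε i ω) := fun ω => by
    simp only [φ]
    rw [Finset.prod_mul_distrib, Finset.prod_ite_mem, Finset.prod_ite_mem,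
      Finset.union_inter_cancel_left, Finset.union_inter_cancel_right]
  simp_rw [e]
  rw [h.integral_prod_comp _ hφ]
  split_ifs with hJK
  · subst hJK
    refine Finset.prod_eq_one fun i hi => ?_
    have hi : i ∈ J := by simpa using hi
    have : ∀ᵐ ω ∂μ, φ i (ε i ω) = 1 := by
      filter_upwards [h.sq_eq_one i] with ω hω
      simp only [φ, hi, if_true]
      rw [← sq, hω]
    rw [integral_congr_ae this]
    simp
  · obtain ⟨i, hi⟩ : ∃ i, ¬ (i ∈ J ↔ i ∈ K) := by
      by_contra! H
      exact hJK (Finset.ext H)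
    have hmem : i ∈ J ∪ K := by
      rw [Finset.mem_union]; tauto
    refine Finset.prod_eq_zero hmem ?_
    rw [← h.integral_eq_zero i]
    congr 1
    ext ω
    simp only [φ]
    by_cases h1 : i ∈ J <;> by_cases h2 : i ∈ K <;> simp_all

/-- The fractional moment of order `1 / 2` of a random Euler product decays. -/
lemma integral_prod_sqrt_le [IsProbabilityMeasure μ] (h : IsRademacherFamily ε μ)
    (J : Finset ι) {a : ι → ℝ} (ha : ∀ i, |a i| ≤ 1) :
    ∫ ω, ∏ i ∈ J, √(1 + ε i ω * a i) ∂μ ≤ Real.exp (-(∑ i ∈ J, a i ^ 2) / 8) := by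
  rw [h.integral_prod_comp (φ := fun i x => √(1 + x * a i)) J (fun i => by fun_prop),
    neg_div, Finset.sum_div, ← Finset.sum_neg_distrib, Real.exp_sum]
  refine Finset.prod_le_prod (fun i _ => integral_nonneg fun ω => Real.sqrt_nonneg _)
    fun i _ => ?_
  obtain ⟨h1, h2⟩ := abs_le.1 (ha i)
  set u := √(1 + a i) with hu
  set v := √(1 - a i) with hv
  have hu2 : u ^ 2 = 1 + a i := Real.sq_sqrt (by linarith)
  have hv2 : v ^ 2 = 1 - a i := Real.sq_sqrt (by linarith)
  have hu0 : 0 ≤ u := Real.sqrt_nonneg _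
  have hv0 : 0 ≤ v := Real.sqrt_nonneg _
  -- On the values `±1` every function of the sign is affine in it, so the mean is `(u + v) / 2`.
  have hae : ∀ᵐ ω ∂μ, √(1 + ε i ω * a i) = (u + v) / 2 + (u - v) / 2 * ε i ω := by
    filter_upwards [h.sq_eq_one i] with ω hω
    rcases sq_eq_sq_iff_eq_or_eq_neg.1 (hω.trans (one_pow 2).symm) with h | h
    · rw [h, one_mul]; ring_nf; rfl
    · rw [h, neg_one_mul, ← sub_eq_add_neg]; ring_nf; rfl
  have hint : Integrable (ε i) μ := by simpa using h.integrable_sum_pow {i} (fun _ => 1) 1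
  rw [integral_congr_ae hae, integral_add (integrable_const _) (hint.const_mul _),
    integral_const_mul, h.integral_eq_zero]
  simp only [integral_const, probReal_univ, one_smul, mul_zero, add_zero]
  refine le_of_sq_le_sq ?_ (Real.exp_pos _).le
  rw [← Real.exp_nat_mul]
  -- Here `u v = √(1 - a²)`, so `((u + v) / 2)² = (1 + u v) / 2 ≤ 1 - a² / 4`; the final square root
  -- turns `exp (-a² / 4)` into `exp (-a² / 8)`.
  have h3 : u * v ≤ 1 - a i ^ 2 / 2 := by
    refine le_of_sq_le_sq ?_ (by nlinarith)
    rw [mul_pow, hu2, hv2]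
    nlinarith [sq_nonneg (a i ^ 2)]
  have h4 := Real.add_one_le_exp (-(a i ^ 2 / 4))
  calc ((u + v) / 2) ^ 2 ≤ -(a i ^ 2 / 4) + 1 := by nlinarith
    _ ≤ _ := h4
    _ = _ := by congr 1; push_cast; ring

end IsRademacherFamily

/-! ### Orthonormality of the random multiplicative function -/

namespace IsRademacherRMF

variable {Ω : Type*} [MeasurableSpace Ω] {μ : Measure Ω} {f : ℕ → Ω → ℝ}

lemma isRademacherFamily [IsProbabilityMeasure μ] (hf : IsRademacherRMF μ f) :
    IsRademacherFamily (fun p : Nat.Primes => f p) μ := by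
  have hA : ∀ p : Nat.Primes, MeasurableSet {ω | f p ω = 1} := fun p =>
    hf.measurable_prime p p.2 (measurableSet_singleton 1)
  have hB : ∀ p : Nat.Primes, MeasurableSet {ω | f p ω = -1} := fun p =>
    hf.measurable_prime p p.2 (measurableSet_singleton (-1))
  have hae : ∀ p : Nat.Primes, ∀ᵐ ω ∂μ, f p ω = 1 ∨ f p ω = -1 := fun p => by
    have hd : Disjoint {ω | f p ω = 1} {ω | f p ω = -1} := by
      rw [Set.disjoint_left]
      intro ω (h1 : f p ω = 1) (h2 : f p ω = -1)
      linarith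
    have : μ ({ω | f p ω = 1} ∪ {ω | f p ω = -1}) = 1 := by
      rw [measure_union hd (hB p), hf.prob_one p p.2, hf.prob_neg_one p p.2,
        ENNReal.add_halves]
    exact (mem_ae_iff_prob_eq_one ((hA p).union (hB p))).2 this
  refine ⟨fun p => hf.measurable_prime p p.2, fun p => ?_, fun p => ?_, hf.indep⟩
  · filter_upwards [hae p] with ω hω
    rcases hω with h | h <;> simp [h]
  · have : ∀ᵐ ω ∂μ, f p ω = {ω | f p ω = 1}.indicator (fun _ => (1 : ℝ)) ω -
        {ω | f p ω = -1}.indicator (fun _ => (1 : ℝ)) ω := by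
      filter_upwards [hae p] with ω hω
      rcases hω with h | h <;> simp [Set.indicator, h] <;> norm_num
    rw [integral_congr_ae this, integral_sub ((integrable_const _).indicator (hA p))
      ((integrable_const _).indicator (hB p)), integral_indicator_const _ (hA p),
      integral_indicator_const _ (hB p), measureReal_def, measureReal_def,
      hf.prob_one p p.2, hf.prob_neg_one p p.2, sub_self]

/-- The values of `f` at an outcome, as an arithmetic function. -/
noncomputable def toArithmeticFunction (f : ℕ → Ω → ℝ) (ω : Ω) : ArithmeticFunction ℝ :=
  ⟨fun n => if n = 0 then 0 else f n ω, by simp⟩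

lemma isMultiplicative (hf : IsRademacherRMF μ f) (ω : Ω) :
    (toArithmeticFunction f ω).IsMultiplicative := by
  refine ArithmeticFunction.IsMultiplicative.iff_ne_zero.2 ⟨?_, fun {m n} hm hn hmn => ?_⟩
  · simpa [toArithmeticFunction] using hf.map_one ω
  · simp [toArithmeticFunction, hm, hn, hf.map_mul m n hmn ω]

lemma eq_prod_primeFactors (hf : IsRademacherRMF μ f) {n : ℕ} (hn : Squarefree n) (ω : Ω) :
    f n ω = ∏ p ∈ n.primeFactors.subtype Nat.Prime, f (p : ℕ) ω := by
  have h1 := (hf.isMultiplicative ω).map_prod_of_subset_primeFactors n n.primeFactors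
    Finset.Subset.rfl
  rw [Nat.prod_primeFactors_of_squarefree hn] at h1
  have h2 : ∀ m : ℕ, m ≠ 0 → toArithmeticFunction f ω m = f m ω := fun m hm => by
    simp [toArithmeticFunction, hm]
  rw [h2 n hn.ne_zero] at h1
  rw [h1, Finset.prod_subtype_of_mem (fun p => f p ω)
    (fun p hp => Nat.prime_of_mem_primeFactors hp)]
  exact Finset.prod_congr rfl fun p hp => h2 p (Nat.prime_of_mem_primeFactors hp).ne_zero

lemma measurable (hf : IsRademacherRMF μ f) (n : ℕ) : Measurable (f n) := by
  by_cases h : Squarefree n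
  · have : f n = fun ω => ∏ p ∈ n.primeFactors.subtype Nat.Prime, f (p : ℕ) ω :=
      funext fun ω => hf.eq_prod_primeFactors h ω
    rw [this]
    exact Finset.measurable_fun_prod _ fun p _ => hf.measurable_prime p p.2
  · have : f n = fun _ => 0 := funext fun ω => hf.map_not_squarefree n h ω
    rw [this]
    exact measurable_const

lemma integral_mul [IsProbabilityMeasure μ] (hf : IsRademacherRMF μ f) {m n : ℕ}
    (hm : Squarefree m) (hn : Squarefree n) :
    ∫ ω, f m ω * f n ω ∂μ = if m = n then 1 else 0 := by
  simp_rw [hf.eq_prod_primeFactors hm, hf.eq_prod_primeFactors hn]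
  refine (hf.isRademacherFamily.integral_prod_mul_prod _ _).trans ?_
  congr 1
  refine propext ⟨fun h => ?_, fun h => by rw [h]⟩
  have h' := congrArg (Finset.map (Function.Embedding.subtype Nat.Prime)) h
  rw [Finset.subtype_map_of_mem (fun p hp => Nat.prime_of_mem_primeFactors hp),
    Finset.subtype_map_of_mem (fun p hp => Nat.prime_of_mem_primeFactors hp)] at h'
  rw [← Nat.prod_primeFactors_of_squarefree hm, ← Nat.prod_primeFactors_of_squarefree hn, h']

end IsRademacherRMF

/-! ### Mellin transform and Euler product compared in mean square -/

/-- Abel summation for the Dirichlet polynomial with coefficients `f`. -/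
lemma sum_mul_cpow_eq_partialSum {Ω : Type*} (f : ℕ → Ω → ℝ) (ω : Ω) (N : ℕ) {s : ℂ}
    (hs : s ≠ 0) :
    ∑ n ∈ Finset.Icc 1 N, (n : ℂ) ^ (-s) * (f n ω : ℂ) =
      (N : ℂ) ^ (-s) * (partialSum f ω N : ℂ) +
        s * ∫ t in Set.Ioc (1 : ℝ) N, (partialSum f ω t : ℂ) * (t : ℂ) ^ (-s - 1) := by
  -- The summation formula starts at `n = 0`, where `f` is arbitrary here, so that coefficient is
  -- set to zero.
  let c : ℕ → ℂ := fun n => if n = 0 then 0 else (f n ω : ℂ)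
  have hc : ∀ n (φ : ℕ → ℂ), ∑ k ∈ Finset.Icc 0 n, φ k * c k =
      ∑ k ∈ Finset.Icc 1 n, φ k * (f k ω : ℂ) := fun n φ => by
    rw [← Finset.add_sum_Ioc_eq_sum_Icc (Nat.zero_le n)]
    simp only [c, if_true, mul_zero, zero_add]
    refine Finset.sum_congr rfl fun k hk => ?_
    rw [if_neg (by have := (Finset.mem_Ioc.1 hk).1; omega)]
  have hc1 : ∀ n, ∑ k ∈ Finset.Icc 0 n, c k = ∑ k ∈ Finset.Icc 1 n, (f k ω : ℂ) := fun n => by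
    simpa using hc n (fun _ => 1)
  have hderiv : ∀ t : ℝ, 1 ≤ t →
      HasDerivAt (fun y : ℝ => (y : ℂ) ^ (-s)) (-s * (t : ℂ) ^ (-s - 1)) t := fun t ht =>
    hasDerivAt_ofReal_cpow_const (by linarith) (neg_ne_zero.2 hs)
  have habel := sum_mul_eq_sub_integral_mul₀' c (f := fun t : ℝ => (t : ℂ) ^ (-s))
    (by simp [c]) N (fun t ht => (hderiv t ht.1).differentiableAt) ?_
  · simp only [Complex.ofReal_natCast] at habel
    rw [hc] at habel
    rw [habel, hc1]
    have e1 : (partialSum f ω (N : ℝ) : ℂ) = ∑ k ∈ Finset.Icc 1 N, (f k ω : ℂ) := by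
      simp [partialSum]
    rw [e1, sub_eq_add_neg, ← integral_neg, ← integral_const_mul]
    congr 1
    refine setIntegral_congr_fun measurableSet_Ioc fun t ht => ?_
    rw [(hderiv t ht.1.le).deriv, hc1]
    simp only [partialSum, Complex.ofReal_sum]
    ring
  · have : ContinuousOn (fun t : ℝ => -s * (t : ℂ) ^ (-s - 1)) (Set.Icc 1 N) := by
      refine continuousOn_const.mul ?_
      refine ContinuousOn.cpow_const (by fun_prop) fun t ht => ?_
      exact Complex.ofReal_mem_slitPlane.2 (by linarith [ht.1])
    refine (this.integrableOn_Icc).congr_fun (fun t ht => ?_) measurableSet_Icc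
    exact ((hderiv t ht.1).deriv).symm

/-- The finite Euler product `∏_{p ≤ N} (1 + f(p) p^{-s})` at the outcome `ω`. -/
noncomputable def eulerProd {Ω : Type*} (f : ℕ → Ω → ℝ) (ω : Ω) (N : ℕ) (s : ℂ) : ℂ :=
  ∏ p ∈ N.primesLE, (1 + (p : ℂ) ^ (-s) * (f p ω : ℂ))

/-- The difference between the truncated Mellin transform of the partial sums and the finite
Euler product. -/
noncomputable def mellinError {Ω : Type*} (f : ℕ → Ω → ℝ) (ω : Ω) (N : ℕ) (s : ℂ) : ℂ :=
  s * (∫ t in Set.Ioc (1 : ℝ) N, (partialSum f ω t : ℂ) * (t : ℂ) ^ (-s - 1)) - eulerProd f ω N s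

lemma norm_natCast_cpow_neg_sq {n : ℕ} (hn : 0 < n) (s : ℂ) :
    ‖(n : ℂ) ^ (-s)‖ ^ 2 = (n : ℝ) ^ (-(2 * s.re)) := by
  rw [Complex.norm_natCast_cpow_of_pos hn, ← Real.rpow_natCast, ← Real.rpow_mul n.cast_nonneg]
  congr 1
  simp
  ring

namespace IsRademacherRMF

variable {Ω : Type*} [MeasurableSpace Ω] {μ : Measure Ω} {f : ℕ → Ω → ℝ}

lemma ae_abs_le_one [IsProbabilityMeasure μ] (hf : IsRademacherRMF μ f) (n : ℕ) :
    ∀ᵐ ω ∂μ, |f n ω| ≤ 1 := by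
  by_cases h : Squarefree n
  · have : ∀ᵐ ω ∂μ, ∀ p : Nat.Primes, |f p ω| = 1 :=
      ae_all_iff.2 fun p => hf.isRademacherFamily.ae_abs_eq_one p
    filter_upwards [this] with ω hω
    rw [hf.eq_prod_primeFactors h, Finset.abs_prod]
    exact (Finset.prod_eq_one fun p _ => hω p).le
  · exact ae_of_all _ fun ω => by simp [hf.map_not_squarefree n h ω]

lemma integrable_mul [IsProbabilityMeasure μ] (hf : IsRademacherRMF μ f) (m n : ℕ) :
    Integrable (fun ω => f m ω * f n ω) μ := by
  refine Integrable.of_bound ((hf.measurable m).mul (hf.measurable n)).aestronglyMeasurable 1 ?_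
  filter_upwards [hf.ae_abs_le_one m, hf.ae_abs_le_one n] with ω h1 h2
  rw [norm_mul]
  exact mul_le_one₀ h1 (norm_nonneg _) h2

lemma integral_sq_sum [IsProbabilityMeasure μ] (hf : IsRademacherRMF μ f) (U : Finset ℕ)
    (hU : ∀ n ∈ U, Squarefree n) (a : ℕ → ℝ) :
    Integrable (fun ω => (∑ n ∈ U, a n * f n ω) ^ 2) μ ∧
      ∫ ω, (∑ n ∈ U, a n * f n ω) ^ 2 ∂μ = ∑ n ∈ U, a n ^ 2 := by
  have e : ∀ ω, (∑ n ∈ U, a n * f n ω) ^ 2 =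
      ∑ m ∈ U, ∑ n ∈ U, a m * a n * (f m ω * f n ω) := fun ω => by
    rw [sq, Finset.sum_mul_sum]
    exact Finset.sum_congr rfl fun m _ => Finset.sum_congr rfl fun n _ => by ring
  simp_rw [e]
  have hi : ∀ m n, Integrable (fun ω => a m * a n * (f m ω * f n ω)) μ := fun m n =>
    (hf.integrable_mul m n).const_mul _
  refine ⟨integrable_finsetSum _ fun m _ => integrable_finsetSum _ fun n _ => hi m n, ?_⟩
  rw [integral_finsetSum _ fun m _ => integrable_finsetSum _ fun n _ => hi m n]
  refine Finset.sum_congr rfl fun m hm => ?_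
  rw [integral_finsetSum _ fun n _ => hi m n, Finset.sum_eq_single_of_mem m hm]
  · rw [integral_const_mul, hf.integral_mul (hU m hm) (hU m hm), if_pos rfl]; ring
  · intro n hn hnm
    rw [integral_const_mul, hf.integral_mul (hU m hm) (hU n hn), if_neg hnm.symm, mul_zero]

lemma integral_norm_sq_sum [IsProbabilityMeasure μ] (hf : IsRademacherRMF μ f) (U : Finset ℕ)
    (hU : ∀ n ∈ U, Squarefree n) (c : ℕ → ℂ) :
    Integrable (fun ω => ‖∑ n ∈ U, c n * (f n ω : ℂ)‖ ^ 2) μ ∧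
      ∫ ω, ‖∑ n ∈ U, c n * (f n ω : ℂ)‖ ^ 2 ∂μ = ∑ n ∈ U, ‖c n‖ ^ 2 := by
  have e : ∀ ω, ‖∑ n ∈ U, c n * (f n ω : ℂ)‖ ^ 2 =
      (∑ n ∈ U, (c n).re * f n ω) ^ 2 + (∑ n ∈ U, (c n).im * f n ω) ^ 2 := fun ω => by
    rw [Complex.sq_norm, Complex.normSq_apply, Complex.re_sum, Complex.im_sum]
    simp [sq]
  have h1 := hf.integral_sq_sum U hU (fun n => (c n).re)
  have h2 := hf.integral_sq_sum U hU (fun n => (c n).im)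
  simp_rw [e]
  refine ⟨h1.1.add h2.1, ?_⟩
  rw [integral_add h1.1 h2.1, h1.2, h2.2, ← Finset.sum_add_distrib]
  exact Finset.sum_congr rfl fun n _ => by
    rw [Complex.sq_norm, Complex.normSq_apply]; ring

/-- The squarefree integers all of whose prime factors are at most `N` are exactly the divisors of
the primorial. The condition `s ≠ 0` makes the summand vanish at `n = 0`. -/
lemma eulerProd_eq_sum (hf : IsRademacherRMF μ f) (ω : Ω) (N : ℕ) {s : ℂ} (hs : s ≠ 0) :
    eulerProd f ω N s = ∑ n ∈ (primorial N).divisors, (n : ℂ) ^ (-s) * (f n ω : ℂ) := by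
  let g : ArithmeticFunction ℂ := ⟨fun n => (n : ℂ) ^ (-s) * (f n ω : ℂ), by simp [hs]⟩
  have hg : g.IsMultiplicative := by
    refine ⟨by simp [g, hf.map_one], fun {m n} hmn => ?_⟩
    simp only [g, ArithmeticFunction.coe_mk]
    rw [hf.map_mul m n hmn, Nat.cast_mul, Complex.natCast_mul_natCast_cpow]
    push_cast
    ring
  have := hg.prodPrimeFactors_one_add_of_squarefree (squarefree_primorial N)
  rw [primeFactors_primorial] at this
  exact this

/-- The Euler product contains every squarefree `n ≤ N`, so after Abel summation two terms survive:
the terms with `n > N`, and the boundary term `N^{-s} M(N)`. Orthonormality bounds their mean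
squares by the tail of `∑ n^{-2σ}` and by `N · N^{-2σ}`. -/
lemma integral_norm_sq_mellinError_le [IsProbabilityMeasure μ] (hf : IsRademacherRMF μ f)
    {N : ℕ} (hN : 0 < N) {s : ℂ} (hs : 1 < 2 * s.re) :
    Integrable (fun ω => ‖mellinError f ω N s‖ ^ 2) μ ∧
    ∫ ω, ‖mellinError f ω N s‖ ^ 2 ∂μ ≤
      2 * (∑' n : ℕ, ((n + (N + 1) : ℕ) : ℝ) ^ (-(2 * s.re))) +
        2 * (N : ℝ) ^ (1 - 2 * s.re) := by
  have hs0 : s ≠ 0 := by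
    rintro rfl
    simp at hs
    linarith
  set U := (primorial N).divisors.filter (fun n => N < n) with hU
  set W := (Finset.Icc 1 N).filter Squarefree with hW
  have hUsq : ∀ n ∈ U, Squarefree n := fun n hn =>
    (squarefree_primorial N).squarefree_of_dvd
      (Nat.dvd_of_mem_divisors (Finset.mem_filter.1 hn).1)
  have hWsq : ∀ n ∈ W, Squarefree n := fun n hn => (Finset.mem_filter.1 hn).2
  have hWsum : ∀ ω (c : ℕ → ℂ), ∑ n ∈ Finset.Icc 1 N, c n * (f n ω : ℂ) =
      ∑ n ∈ W, c n * (f n ω : ℂ) := fun ω c => by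
    refine (Finset.sum_filter_of_ne fun n _ hne => ?_).symm
    by_contra hsq
    exact hne (by rw [hf.map_not_squarefree n hsq]; simp)
  have hWdiv : W = (primorial N).divisors.filter (fun n => ¬ N < n) := by
    ext n
    simp only [hW, Finset.mem_filter, Finset.mem_Icc, Nat.mem_divisors, not_lt]
    constructor
    · rintro ⟨⟨h1, h2⟩, h3⟩
      exact ⟨⟨h3.dvd_primorial.trans (primorial_dvd_primorial h2), primorial_ne_zero N⟩, h2⟩
    · rintro ⟨⟨h1, _⟩, h2⟩
      exact ⟨⟨Nat.pos_of_dvd_of_pos h1 (primorial_pos N), h2⟩,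
        (squarefree_primorial N).squarefree_of_dvd h1⟩
  have hE : ∀ ω, mellinError f ω N s = -(∑ n ∈ U, (n : ℂ) ^ (-s) * (f n ω : ℂ)) -
      ∑ n ∈ W, (N : ℂ) ^ (-s) * (f n ω : ℂ) := fun ω => by
    have h1 := sum_mul_cpow_eq_partialSum f ω N hs0
    have h2 := hf.eulerProd_eq_sum ω N hs0
    rw [← Finset.sum_filter_add_sum_filter_not _ (fun n => N < n), ← hWdiv] at h2
    rw [hWsum ω (fun n => (n : ℂ) ^ (-s))] at h1
    have h3 : (N : ℂ) ^ (-s) * (partialSum f ω N : ℂ) =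
        ∑ n ∈ W, (N : ℂ) ^ (-s) * (f n ω : ℂ) := by
      rw [← hWsum ω (fun _ => (N : ℂ) ^ (-s)), partialSum, Nat.floor_natCast,
        Complex.ofReal_sum, Finset.mul_sum]
    rw [mellinError, h2, ← h3]
    linear_combination -h1
  have hA := hf.integral_norm_sq_sum U hUsq (fun n => (n : ℂ) ^ (-s))
  have hB := hf.integral_norm_sq_sum W hWsq (fun _ => (N : ℂ) ^ (-s))
  have hle : ∀ ω, ‖mellinError f ω N s‖ ^ 2 ≤ 2 * ‖∑ n ∈ U, (n : ℂ) ^ (-s) * (f n ω : ℂ)‖ ^ 2 +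
      2 * ‖∑ n ∈ W, (N : ℂ) ^ (-s) * (f n ω : ℂ)‖ ^ 2 := fun ω => by
    rw [hE ω]
    have := norm_sub_le (-(∑ n ∈ U, (n : ℂ) ^ (-s) * (f n ω : ℂ)))
      (∑ n ∈ W, (N : ℂ) ^ (-s) * (f n ω : ℂ))
    rw [norm_neg] at this
    refine (pow_le_pow_left₀ (norm_nonneg _) this 2).trans ?_
    nlinarith [sq_nonneg (‖∑ n ∈ U, (n : ℂ) ^ (-s) * (f n ω : ℂ)‖ -
      ‖∑ n ∈ W, (N : ℂ) ^ (-s) * (f n ω : ℂ)‖)]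
  have hint := (hA.1.const_mul 2).fun_add (hB.1.const_mul 2)
  have hmeas : Measurable fun ω => mellinError f ω N s := by
    simp_rw [hE]
    have hm := hf.measurable
    have : ∀ n, Measurable fun ω => (f n ω : ℂ) := fun n =>
      Complex.measurable_ofReal.comp (hm n)
    exact (Finset.measurable_fun_sum _ fun n _ => (this n).const_mul _).neg.sub
      (Finset.measurable_fun_sum _ fun n _ => (this n).const_mul _)
  have hInt : Integrable (fun ω => ‖mellinError f ω N s‖ ^ 2) μ :=
    hint.mono' (hmeas.norm.pow_const 2).aestronglyMeasurable (ae_of_all _ fun ω => by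
      rw [Real.norm_of_nonneg (by positivity)]; exact hle ω)
  refine ⟨hInt, ?_⟩
  refine (integral_mono hInt hint hle).trans ?_
  rw [integral_add (hA.1.const_mul 2) (hB.1.const_mul 2), integral_const_mul,
    integral_const_mul, hA.2, hB.2]
  have hUle : ∑ n ∈ U, ‖(n : ℂ) ^ (-s)‖ ^ 2 ≤
      ∑' n : ℕ, ((n + (N + 1) : ℕ) : ℝ) ^ (-(2 * s.re)) := by
    have hsum : Summable fun n : ℕ => (n : ℝ) ^ (-(2 * s.re)) :=
      Real.summable_nat_rpow.2 (by linarith)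
    have hsum' := (summable_nat_add_iff (N + 1)).2 hsum
    have e : ∑ n ∈ U, ‖(n : ℂ) ^ (-s)‖ ^ 2 =
        ∑ m ∈ U.image (fun n => n - (N + 1)), ((m + (N + 1) : ℕ) : ℝ) ^ (-(2 * s.re)) := by
      have hlt : ∀ n ∈ U, N < n := fun n hn => (Finset.mem_filter.1 hn).2
      rw [Finset.sum_image]
      · refine Finset.sum_congr rfl fun n hn => ?_
        have := hlt n hn
        rw [norm_natCast_cpow_neg_sq (by omega), Nat.sub_add_cancel this]
      · intro a ha b hb (hab : a - (N + 1) = b - (N + 1))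
        have := hlt a ha
        have := hlt b hb
        omega
    rw [e]
    exact hsum'.sum_le_tsum _ fun n _ => Real.rpow_nonneg (Nat.cast_nonneg _) _
  have hWle : ∑ n ∈ W, ‖(N : ℂ) ^ (-s)‖ ^ 2 ≤ (N : ℝ) ^ (1 - 2 * s.re) := by
    rw [Finset.sum_const, nsmul_eq_mul, norm_natCast_cpow_neg_sq hN, sub_eq_add_neg,
      Real.rpow_add (by exact_mod_cast hN), Real.rpow_one]
    refine mul_le_mul_of_nonneg_right ?_ (Real.rpow_nonneg (Nat.cast_nonneg _) _)
    have : W.card ≤ N := (Finset.card_filter_le _ _).trans (by simp)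
    exact_mod_cast this
  linarith

end IsRademacherRMF

/-! ### Choice of the abscissae and cut-offs -/

open scoped Topology in
/-- The abscissae `σ` and cut-offs `N` along which Euler products are compared with Mellin
transforms: all error terms are small, the variance is large and `∏ (1 - p^{-2s})` at
`s = σ + i` stays in a compact subset of `(0, ∞)`. -/
lemma exists_abscissa_cutoff : ∃ c C : ℝ, 0 < c ∧ ∀ k : ℕ, ∃ (σ : ℝ) (N : ℕ),
    1 / 2 < σ ∧ σ < 1 ∧ 0 < N ∧
    2 * (∑' n : ℕ, ((n + (N + 1) : ℕ) : ℝ) ^ (-(2 * σ))) + 2 * (N : ℝ) ^ (1 - 2 * σ) ≤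
      (1 / 4) ^ k ∧
    (k : ℝ) ≤ ∑ p ∈ N.primesLE, (p : ℝ) ^ (-(2 * σ)) ∧
    c ≤ ∏ p ∈ N.primesLE, ‖1 - (p : ℂ) ^ (-(2 * (σ + Complex.I)))‖ ∧
    ∏ p ∈ N.primesLE, ‖1 - (p : ℂ) ^ (-(2 * (σ + Complex.I)))‖ ≤ C := by
  -- The product `∏ (1 - p^{-2s})` tends to `1 / ζ(2s)` as `N → ∞`, and `2s → 1 + 2i` as `σ → 1/2`.
  -- Nonvanishing of zeta on the line of real part `1` makes the limit `r` positive, and `r / 2`,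
  -- `2r` are margins around it.
  set r := ‖riemannZeta (1 + 2 * Complex.I)‖⁻¹ with hr
  have hz : riemannZeta (1 + 2 * Complex.I) ≠ 0 :=
    riemannZeta_ne_zero_of_one_le_re (by simp)
  have hr0 : 0 < r := inv_pos.2 (norm_pos_iff.2 hz)
  refine ⟨r / 2, 2 * r, by positivity, fun k => ?_⟩
  have hzeta : Tendsto (fun σ : ℝ => ‖riemannZeta (2 * (σ + Complex.I))‖⁻¹) (𝓝[>] (1 / 2)) (𝓝 r) := by
    have h1 : ContinuousAt riemannZeta (1 + 2 * Complex.I) := by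
      refine (differentiableAt_riemannZeta fun h => ?_).continuousAt
      have := congrArg Complex.im h
      simp at this
    have h2 : Tendsto (fun σ : ℝ => 2 * ((σ : ℂ) + Complex.I)) (𝓝[>] (1 / 2))
        (𝓝 (1 + 2 * Complex.I)) := by
      have : Continuous fun σ : ℝ => 2 * ((σ : ℂ) + Complex.I) := by fun_prop
      have h := this.tendsto (1 / 2)
      refine (h.mono_left nhdsWithin_le_nhds).congr' (by rfl) |>.trans (le_of_eq ?_)
      congr 1
      push_cast
      ring
    exact ((h1.tendsto.comp h2).norm).inv₀ (norm_ne_zero_iff.2 hz)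
  -- The order of choices matters: `P` from the divergence of `∑ 1/p`, then `σ` close enough to
  -- `1/2` that the sum up to `P` remains large, and finally `N > P` in terms of `σ` so that the
  -- error terms are small.
  obtain ⟨P, hP⟩ : ∃ P : ℕ, (k : ℝ) + 1 < ∑ p ∈ P.primesLE, (p : ℝ) ^ (-(2 * (1 / 2 : ℝ))) := by
    have h := not_summable_iff_tendsto_nat_atTop_of_nonneg
      (f := Set.indicator {p : ℕ | p.Prime} (fun n => (1 : ℝ) / n))
      (fun n => Set.indicator_nonneg (fun _ _ => by positivity) _) |>.1
      not_summable_one_div_on_primes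
    obtain ⟨n, hn⟩ := (h.eventually_gt_atTop ((k : ℝ) + 1)).exists
    refine ⟨n, hn.trans_le ?_⟩
    have e : ∑ i ∈ Finset.range n, Set.indicator {p : ℕ | p.Prime} (fun n => (1 : ℝ) / n) i =
        ∑ p ∈ n.primesBelow, (p : ℝ) ^ (-(2 * (1 / 2 : ℝ))) := by
      rw [Nat.primesBelow_eq_filter_range, Finset.sum_filter]
      refine Finset.sum_congr rfl fun i _ => ?_
      by_cases hi : i.Prime
      · simp [Set.indicator, hi, Real.rpow_neg_one]
      · simp [Set.indicator, hi]
    rw [e]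
    refine Finset.sum_le_sum_of_subset_of_nonneg (fun p hp => ?_)
      fun p _ _ => Real.rpow_nonneg (Nat.cast_nonneg _) _
    rw [Nat.mem_primesBelow] at hp
    exact Nat.mem_primesLE.2 ⟨hp.1.le, hp.2⟩
  have hPlim : Tendsto (fun σ : ℝ => ∑ p ∈ P.primesLE, (p : ℝ) ^ (-(2 * σ))) (𝓝[>] (1 / 2))
      (𝓝 (∑ p ∈ P.primesLE, (p : ℝ) ^ (-(2 * (1 / 2 : ℝ))))) := by
    refine tendsto_finsetSum _ fun p hp => ?_
    have hp0 : (p : ℝ) ≠ 0 := by exact_mod_cast (Nat.prime_of_mem_primesLE hp).ne_zero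
    have : Continuous fun σ : ℝ => (p : ℝ) ^ (-(2 * σ)) :=
      Continuous.rpow continuous_const (by fun_prop) fun _ => Or.inl hp0
    exact (this.tendsto _).mono_left nhdsWithin_le_nhds
  have hσ1 : ∀ᶠ σ : ℝ in 𝓝[>] (1 / 2), σ < 1 :=
    nhdsWithin_le_nhds (Iio_mem_nhds (by norm_num))
  obtain ⟨σ, ⟨hσ, hσ2⟩, hσP, hσl, hσu⟩ := ((eventually_mem_nhdsWithin.and hσ1).and
    ((hPlim.eventually (lt_mem_nhds hP)).and ((hzeta.eventually (lt_mem_nhds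
      (half_lt_self hr0))).and (hzeta.eventually (gt_mem_nhds (by linarith : r < 2 * r)))))).exists
  have hσ' : 1 / 2 < σ := hσ
  have hre : 1 < (2 * ((σ : ℂ) + Complex.I)).re := by simp; linarith
  have hprod : Tendsto (fun N : ℕ => ∏ p ∈ N.primesLE,
      ‖1 - (p : ℂ) ^ (-(2 * (σ + Complex.I)))‖) atTop
      (𝓝 ‖riemannZeta (2 * (σ + Complex.I))‖⁻¹) := by
    have h := ((riemannZeta_eulerProduct hre).norm.inv₀ (norm_ne_zero_iff.2
      (riemannZeta_ne_zero_of_one_le_re hre.le))).comp (tendsto_add_atTop_nat 1)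
    refine h.congr fun N => ?_
    simp only [Function.comp, norm_prod, norm_inv, Finset.prod_inv_distrib, inv_inv]
    rfl
  have htail : Tendsto (fun N : ℕ => 2 * (∑' n : ℕ, ((n + (N + 1) : ℕ) : ℝ) ^ (-(2 * σ))) +
      2 * (N : ℝ) ^ (1 - 2 * σ)) atTop (𝓝 (2 * 0 + 2 * 0)) := by
    refine Tendsto.add (Tendsto.const_mul _ ?_) (Tendsto.const_mul _ ?_)
    · exact (tendsto_sum_nat_add fun n : ℕ => (n : ℝ) ^ (-(2 * σ))).comp (tendsto_add_atTop_nat 1)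
    · have := (tendsto_rpow_neg_atTop (y := 2 * σ - 1) (by linarith)).comp
        tendsto_natCast_atTop_atTop
      simpa [Function.comp_def] using this
  rw [mul_zero, add_zero] at htail
  obtain ⟨N, hN⟩ := ((eventually_ge_atTop (P + 1)).and ((htail.eventually (ge_mem_nhds
    (by positivity : (0 : ℝ) < (1 / 4) ^ k))).and ((hprod.eventually (lt_mem_nhds hσl)).and
    (hprod.eventually (gt_mem_nhds hσu))))).exists
  refine ⟨σ, N, hσ, hσ2, by omega, hN.2.1, ?_, hN.2.2.1.le, hN.2.2.2.le⟩
  refine (by linarith : (k : ℝ) ≤ ∑ p ∈ P.primesLE, (p : ℝ) ^ (-(2 * σ))).trans ?_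
  refine Finset.sum_le_sum_of_subset_of_nonneg (fun p hp => ?_)
    fun p _ _ => Real.rpow_nonneg (Nat.cast_nonneg _) _
  rw [Nat.mem_primesLE] at hp ⊢
  exact ⟨by omega, hp.2⟩

/-! ### Logarithms of Euler factors and auxiliary bounds -/

/-- Half the logarithm of `|1 + z| / |1 - z|`. -/
noncomputable def halfLogRatio (z : ℂ) : ℝ := (Real.log ‖1 + z‖ - Real.log ‖1 - z‖) / 2

lemma one_sub_norm_le_norm_one_add (z : ℂ) : 1 - ‖z‖ ≤ ‖1 + z‖ := by
  have := norm_sub_norm_le (1 : ℂ) (-z)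
  simpa using this

lemma norm_one_add_pos {z : ℂ} (hz : ‖z‖ < 1) : 0 < ‖1 + z‖ :=
  (sub_pos.2 hz).trans_le (one_sub_norm_le_norm_one_add z)

lemma norm_one_sub_pos {z : ℂ} (hz : ‖z‖ < 1) : 0 < ‖1 - z‖ := by
  simpa [sub_eq_add_neg] using norm_one_add_pos (z := -z) (by simpa using hz)

lemma norm_one_sub_sq (z : ℂ) : ‖1 - z ^ 2‖ = ‖1 + z‖ * ‖1 - z‖ := by
  rw [← norm_mul]; ring_nf

/-- Since `x = ±1`, the logarithm is affine in `x`; its mean over the two signs is `log |1 - z²| /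
2` and its slope is half the difference of the two values. -/
lemma log_norm_one_add_mul {z : ℂ} (hz : ‖z‖ < 1) {x : ℝ} (hx : x ^ 2 = 1) :
    Real.log ‖1 + z * (x : ℂ)‖ = Real.log ‖1 - z ^ 2‖ / 2 + halfLogRatio z * x := by
  rw [norm_one_sub_sq, Real.log_mul (norm_one_add_pos hz).ne' (norm_one_sub_pos hz).ne',
    halfLogRatio]
  rcases sq_eq_sq_iff_eq_or_eq_neg.1 (hx.trans (one_pow 2).symm) with h | h
  · rw [h]; simp; ring
  · rw [h]; simp [← sub_eq_add_neg]; ring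

/-- With `h = halfLogRatio z`, the parallelogram law gives `cosh (2h) |1 - z²| = 1 + |z|²`, and
`cosh x ≤ exp (x² / 2)`. Multiplied over primes, this bounds the variance `∑ h²` from below without
expanding any logarithm. -/
lemma one_add_norm_sq_le {z : ℂ} (hz : ‖z‖ < 1) :
    1 + ‖z‖ ^ 2 ≤ ‖1 - z ^ 2‖ * Real.exp (2 * halfLogRatio z ^ 2) := by
  have ha := norm_one_add_pos hz
  have hb := norm_one_sub_pos hz
  have h := Real.cosh_le_exp_half_sq (2 * halfLogRatio z)
  have e : 2 * halfLogRatio z = Real.log (‖1 + z‖ / ‖1 - z‖) := by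
    rw [halfLogRatio, Real.log_div ha.ne' hb.ne']; ring
  have hpar : ‖1 + z‖ ^ 2 + ‖1 - z‖ ^ 2 = 2 * (1 + ‖z‖ ^ 2) := by
    have := parallelogram_law_with_norm ℝ (1 : ℂ) z
    rw [norm_one] at this
    linear_combination this
  have hc : Real.cosh (2 * halfLogRatio z) * ‖1 - z ^ 2‖ = 1 + ‖z‖ ^ 2 := by
    rw [e, Real.cosh_log (by positivity), norm_one_sub_sq]
    field_simp
    linear_combination hpar
  rw [← hc, mul_comm]
  refine mul_le_mul_of_nonneg_left (h.trans (le_of_eq ?_)) (norm_nonneg _)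
  congr 1
  ring

lemma abs_halfLogRatio_le {z : ℂ} (hz : ‖z‖ ≤ 3 / 4) : |halfLogRatio z| ≤ 3 := by
  have key : ∀ w : ℂ, ‖w‖ ≤ 3 / 4 → |Real.log ‖1 + w‖| ≤ 3 := fun w hw => by
    have h1 := one_sub_norm_le_norm_one_add w
    have h2 : ‖1 + w‖ ≤ 1 + ‖w‖ := by simpa using norm_add_le (1 : ℂ) w
    have h0 : 0 < ‖1 + w‖ := by linarith
    have h3 := Real.log_le_sub_one_of_pos h0
    have h4 := Real.one_sub_inv_le_log_of_pos h0
    have h5 : ‖1 + w‖⁻¹ ≤ 4 := inv_le_of_inv_le₀ (by norm_num) (by linarith)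
    rw [abs_le]
    constructor <;> linarith
  have h1 := abs_le.1 (key z hz)
  have h2 := abs_le.1 (key (-z) (by simpa using hz))
  rw [← sub_eq_add_neg] at h2
  rw [halfLogRatio, abs_le]
  constructor <;> linarith

lemma norm_prime_cpow_neg {p : ℕ} (hp : p.Prime) (s : ℂ) : ‖(p : ℂ) ^ (-s)‖ = (p : ℝ) ^ (-s.re) := by
  rw [Complex.norm_natCast_cpow_of_pos hp.pos, Complex.neg_re]

lemma rpow_neg_prime_le {p : ℕ} (hp : p.Prime) {σ : ℝ} (hσ : 1 / 2 < σ) :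
    (p : ℝ) ^ (-σ) ≤ 3 / 4 := by
  have hp2 : (2 : ℝ) ≤ p := by exact_mod_cast hp.two_le
  calc (p : ℝ) ^ (-σ) ≤ (p : ℝ) ^ (-(1 / 2 : ℝ)) :=
        Real.rpow_le_rpow_of_exponent_le (by linarith) (by linarith)
    _ ≤ 2 ^ (-(1 / 2 : ℝ)) := Real.rpow_le_rpow_of_nonpos (by norm_num) hp2 (by norm_num)
    _ ≤ 3 / 4 := by
      rw [Real.rpow_neg (by norm_num), ← Real.sqrt_eq_rpow]
      refine inv_le_of_inv_le₀ (by norm_num) (Real.le_sqrt_of_sq_le (by norm_num))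

lemma one_add_sum_le_prod {ι : Type*} (J : Finset ι) {a : ι → ℝ} (ha : ∀ i ∈ J, 0 ≤ a i) :
    1 + ∑ i ∈ J, a i ≤ ∏ i ∈ J, (1 + a i) := by
  classical
  induction J using Finset.induction_on with
  | empty => simp
  | insert i J hi ih =>
    rw [Finset.sum_insert hi, Finset.prod_insert hi]
    have h1 := ih fun j hj => ha j (Finset.mem_insert_of_mem hj)
    have h2 := ha i (Finset.mem_insert_self i J)
    have h3 : 0 ≤ ∑ j ∈ J, a j :=
      Finset.sum_nonneg fun j hj => ha j (Finset.mem_insert_of_mem hj)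
    nlinarith

-- The expectations are summable, so `∑ X k` is almost surely finite and its terms tend to zero.
open scoped Topology in
lemma ae_tendsto_zero_of_integral_le_pow {Ω : Type*} [MeasurableSpace Ω] {μ : Measure Ω}
    {X : ℕ → Ω → ℝ} {r : ℝ} (hr : r < 1) (hr0 : 0 ≤ r) (hX : ∀ k ω, 0 ≤ X k ω)
    (hint : ∀ k, Integrable (X k) μ) (hle : ∀ k, ∫ ω, X k ω ∂μ ≤ r ^ k) :
    ∀ᵐ ω ∂μ, Tendsto (fun k => X k ω) atTop (𝓝 0) := by
  have hm : ∀ k, AEMeasurable (fun ω => ENNReal.ofReal (X k ω)) μ := fun k =>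
    (hint k).aemeasurable.ennreal_ofReal
  have hfin : ∫⁻ ω, ∑' k, ENNReal.ofReal (X k ω) ∂μ ≠ ⊤ := by
    rw [lintegral_tsum hm]
    have : ∀ k, ∫⁻ ω, ENNReal.ofReal (X k ω) ∂μ ≤ ENNReal.ofReal (r ^ k) := fun k => by
      rw [← ofReal_integral_eq_lintegral_ofReal (hint k) (ae_of_all _ (hX k))]
      exact ENNReal.ofReal_le_ofReal (hle k)
    refine ne_top_of_le_ne_top ?_ (ENNReal.tsum_le_tsum this)
    exact (summable_geometric_of_lt_one hr0 hr).tsum_ofReal_ne_top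
  filter_upwards [ae_lt_top' (AEMeasurable.tsum hm) hfin] with ω hω
  have h1 := ENNReal.tendsto_atTop_zero_of_tsum_ne_top hω.ne
  have h2 := (ENNReal.tendsto_toReal ENNReal.zero_ne_top).comp h1
  refine h2.congr fun k => ?_
  simp [hX k ω]

/-! ### Almost sure behaviour of the Euler products at `σ` and `σ + i` -/

namespace IsRademacherRMF

variable {Ω : Type*} [MeasurableSpace Ω] {μ : Measure Ω} {f : ℕ → Ω → ℝ}

/-- The primes `p ≤ N` as a finite subset of `Nat.Primes`. -/
def primesUpTo (N : ℕ) : Finset Nat.Primes := N.primesLE.subtype Nat.Prime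

lemma primesLE_prod {M : Type*} [CommMonoid M] (N : ℕ) (g : ℕ → M) :
    ∏ p ∈ N.primesLE, g p = ∏ p ∈ primesUpTo N, g p :=
  (Finset.prod_subtype_of_mem g fun _ hp => Nat.prime_of_mem_primesLE hp).symm

lemma primesLE_sum {M : Type*} [AddCommMonoid M] (N : ℕ) (g : ℕ → M) :
    ∑ p ∈ N.primesLE, g p = ∑ p ∈ primesUpTo N, g p :=
  (Finset.sum_subtype_of_mem g fun _ hp => Nat.prime_of_mem_primesLE hp).symm

open scoped Topology in
/-- The Mellin transforms are asymptotic to the Euler products. -/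
lemma ae_tendsto_mellinError [IsProbabilityMeasure μ] (hf : IsRademacherRMF μ f)
    {s : ℕ → ℂ} {N : ℕ → ℕ} (hs : ∀ k, 1 < 2 * (s k).re) (hN : ∀ k, 0 < N k)
    (h : ∀ k, 2 * (∑' n : ℕ, ((n + (N k + 1) : ℕ) : ℝ) ^ (-(2 * (s k).re))) +
      2 * (N k : ℝ) ^ (1 - 2 * (s k).re) ≤ (1 / 4) ^ k) :
    ∀ᵐ ω ∂μ, Tendsto (fun k => ‖mellinError f ω (N k) (s k)‖) atTop (𝓝 0) := by
  have := ae_tendsto_zero_of_integral_le_pow (μ := μ)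
    (X := fun k ω => ‖mellinError f ω (N k) (s k)‖ ^ 2) (r := 1 / 4) (by norm_num) (by norm_num)
    (fun k ω => by positivity) (fun k => (hf.integral_norm_sq_mellinError_le (hN k) (hs k)).1)
    (fun k => (hf.integral_norm_sq_mellinError_le (hN k) (hs k)).2.trans (h k))
  filter_upwards [this] with ω hω
  have h2 := (Real.continuous_sqrt.tendsto 0).comp hω
  rw [Real.sqrt_zero] at h2
  exact h2.congr fun k => Real.sqrt_sq (norm_nonneg _)

open scoped Topology in
/-- On the real axis the Euler products tend to zero. -/
lemma ae_tendsto_eulerProd_real [IsProbabilityMeasure μ] (hf : IsRademacherRMF μ f)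
    {σ : ℕ → ℝ} {N : ℕ → ℕ} (hσ : ∀ k, 1 / 2 < σ k)
    (h : ∀ k : ℕ, (k : ℝ) ≤ ∑ p ∈ (N k).primesLE, (p : ℝ) ^ (-(2 * σ k))) :
    ∀ᵐ ω ∂μ, Tendsto (fun k => ‖eulerProd f ω (N k) (σ k)‖) atTop (𝓝 0) := by
  have hfam := hf.isRademacherFamily
  let a : ℕ → Nat.Primes → ℝ := fun k p => ((p : ℕ) : ℝ) ^ (-σ k)
  have ha0 : ∀ k p, 0 ≤ a k p := fun k p => Real.rpow_nonneg (Nat.cast_nonneg _) _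
  have ha1 : ∀ k p, a k p ≤ 3 / 4 := fun k p => rpow_neg_prime_le p.2 (hσ k)
  have ha : ∀ k p, |a k p| ≤ 1 := fun k p => by
    rw [abs_of_nonneg (ha0 k p)]; linarith [ha1 k p]
  -- This is `√|F(σ)|`; its mean decays geometrically in `k`, with ratio `exp (-1/8)`.
  let X : ℕ → Ω → ℝ := fun k ω =>
    ∏ p ∈ primesUpTo (N k), √(1 + f (p : ℕ) ω * a k p)
  have hbd : ∀ᵐ ω ∂μ, ∀ p : Nat.Primes, |f p ω| = 1 := ae_all_iff.2 hfam.ae_abs_eq_one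
  have hXint : ∀ k, Integrable (X k) μ := fun k => by
    refine Integrable.of_bound (Measurable.aestronglyMeasurable ?_)
      (∏ p ∈ primesUpTo (N k), √2) ?_
    · refine Finset.measurable_fun_prod _ fun p _ => ?_
      exact (((hf.measurable p).mul_const _).const_add 1).sqrt
    · filter_upwards [hbd] with ω hω
      rw [Real.norm_eq_abs, Finset.abs_prod]
      refine Finset.prod_le_prod (fun p _ => abs_nonneg _) fun p _ => ?_
      rw [abs_of_nonneg (Real.sqrt_nonneg _)]
      refine Real.sqrt_le_sqrt ?_
      have : f p ω * a k p ≤ 1 := by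
        refine (le_abs_self _).trans ?_
        rw [abs_mul, hω p, one_mul]; exact ha k p
      linarith
  have hXle : ∀ k, ∫ ω, X k ω ∂μ ≤ Real.exp (-(1 / 8)) ^ k := fun k => by
    refine (hfam.integral_prod_sqrt_le _ (ha k)).trans ?_
    rw [← Real.exp_nat_mul]
    refine Real.exp_le_exp.2 ?_
    have := h k
    rw [primesLE_sum] at this
    have e : ∑ p ∈ primesUpTo (N k), a k p ^ 2 =
        ∑ p ∈ primesUpTo (N k), ((p : ℕ) : ℝ) ^ (-(2 * σ k)) :=
      Finset.sum_congr rfl fun p _ => by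
        simp only [a]
        rw [← Real.rpow_natCast, ← Real.rpow_mul (Nat.cast_nonneg _)]
        congr 1
        push_cast
        ring
    have e' := e.symm ▸ this
    linarith
  filter_upwards [hbd, ae_tendsto_zero_of_integral_le_pow (μ := μ)
    (Real.exp_lt_one_iff.2 (by norm_num : -(1 / 8 : ℝ) < 0)) (Real.exp_pos _).le
    (fun k ω => Finset.prod_nonneg fun p _ => Real.sqrt_nonneg _) hXint hXle] with ω hω hX
  have h2 := hX.pow 2
  rw [zero_pow two_ne_zero] at h2
  refine h2.congr fun k => ?_
  rw [eulerProd, norm_prod, primesLE_prod, ← Finset.prod_pow]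
  refine Finset.prod_congr rfl fun p _ => ?_
  have h1 : |f p ω * a k p| ≤ 1 := by rw [abs_mul, hω p, one_mul]; exact ha k p
  have h3 : 0 ≤ 1 + f p ω * a k p := by linarith [(abs_le.1 h1).1]
  rw [Real.sq_sqrt h3]
  have e : (1 + ((p : ℕ) : ℂ) ^ (-(σ k : ℂ)) * (f p ω : ℂ)) = ((1 + f p ω * a k p : ℝ) : ℂ) := by
    simp only [a]
    push_cast
    rw [Complex.ofReal_cpow (Nat.cast_nonneg _)]
    push_cast
    ring
  rw [e, Complex.norm_real, Real.norm_of_nonneg h3]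

/-- Off the real axis the Euler products are unbounded. -/
lemma ae_not_bddAbove_norm_eulerProd [IsProbabilityMeasure μ] (hf : IsRademacherRMF μ f)
    {s : ℕ → ℂ} {N : ℕ → ℕ} (hs : ∀ k, 1 / 2 < (s k).re) {c C : ℝ} (hc : 0 < c)
    (h : ∀ k : ℕ, (k : ℝ) ≤ ∑ p ∈ (N k).primesLE, (p : ℝ) ^ (-(2 * (s k).re)))
    (hlow : ∀ k, c ≤ ∏ p ∈ (N k).primesLE, ‖1 - (p : ℂ) ^ (-(2 * s k))‖)
    (hupp : ∀ k, ∏ p ∈ (N k).primesLE, ‖1 - (p : ℂ) ^ (-(2 * s k))‖ ≤ C) :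
    ∀ᵐ ω ∂μ, ¬ BddAbove (Set.range fun k => ‖eulerProd f ω (N k) (s k)‖) := by
  have hfam := hf.isRademacherFamily
  let z : ℕ → Nat.Primes → ℂ := fun k p => ((p : ℕ) : ℂ) ^ (-s k)
  let J : ℕ → Finset Nat.Primes := fun k => primesUpTo (N k)
  have hz : ∀ k p, ‖z k p‖ ≤ 3 / 4 := fun k p => by
    simp only [z]
    rw [norm_prime_cpow_neg p.2]
    exact rpow_neg_prime_le p.2 (hs k)
  have hz1 : ∀ k p, ‖z k p‖ < 1 := fun k p => (hz k p).trans_lt (by norm_num)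
  have hz2 : ∀ k, ∏ p ∈ (N k).primesLE, ‖1 - (p : ℂ) ^ (-(2 * s k))‖ =
      ∏ p ∈ J k, ‖1 - z k p ^ 2‖ := fun k => by
    rw [primesLE_prod]
    refine Finset.prod_congr rfl fun p _ => ?_
    simp only [z]
    rw [← Complex.cpow_nat_mul]
    congr 3
    push_cast
    ring
  simp_rw [hz2] at hlow hupp
  have hC : 0 < C := hc.trans_le ((hlow 0).trans (hupp 0))
  -- The variance grows at least like `log (k / C) / 2`, from `k ≤ ∏ (1 + |z|²) ≤ C exp (2 ∑ h²)`.
  -- For `k = 0` the left side is zero by the convention `log 0 = 0`.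
  have hV : Tendsto (fun k => ∑ p ∈ J k, halfLogRatio (z k p) ^ 2) atTop atTop := by
    have hk : ∀ k : ℕ, Real.log ((k : ℝ) / C) / 2 ≤
        ∑ p ∈ J k, halfLogRatio (z k p) ^ 2 := fun k => by
      rcases Nat.eq_zero_or_pos k with rfl | hk0
      · simp only [Nat.cast_zero, zero_div, Real.log_zero]
        exact Finset.sum_nonneg fun p _ => sq_nonneg _
      have hk0' : (0 : ℝ) < k := by exact_mod_cast hk0
      have h1 : (k : ℝ) ≤ ∏ p ∈ J k, (1 + ‖z k p‖ ^ 2) := by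
        refine le_trans ?_ (one_add_sum_le_prod (J k) fun p _ => sq_nonneg ‖z k p‖)
        have h2 := h k
        rw [primesLE_sum] at h2
        have e : ∑ p ∈ J k, ‖z k p‖ ^ 2 = ∑ p ∈ J k, ((p : ℕ) : ℝ) ^ (-(2 * (s k).re)) :=
          Finset.sum_congr rfl fun p _ => norm_natCast_cpow_neg_sq p.2.pos _
        rw [e]
        linarith
      have h3 : ∏ p ∈ J k, (1 + ‖z k p‖ ^ 2) ≤
          (∏ p ∈ J k, ‖1 - z k p ^ 2‖) * Real.exp (2 * ∑ p ∈ J k, halfLogRatio (z k p) ^ 2) := by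
        rw [Finset.mul_sum, Real.exp_sum, ← Finset.prod_mul_distrib]
        exact Finset.prod_le_prod (fun p _ => by positivity) fun p _ => one_add_norm_sq_le (hz1 k p)
      have h4 : (k : ℝ) / C ≤ Real.exp (2 * ∑ p ∈ J k, halfLogRatio (z k p) ^ 2) := by
        rw [div_le_iff₀' hC]
        exact h1.trans (h3.trans (mul_le_mul_of_nonneg_right (hupp k) (Real.exp_pos _).le))
      have h5 := Real.log_le_log (div_pos hk0' hC) h4
      rw [Real.log_exp] at h5
      linarith
    refine tendsto_atTop_mono hk ?_
    exact (Real.tendsto_log_atTop.comp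
      (tendsto_natCast_atTop_atTop.atTop_div_const hC)).atTop_div_const two_pos
  have hunb := hfam.ae_not_bddAbove (b := fun k p => halfLogRatio (z k p)) (J := J)
    (fun k p => abs_halfLogRatio_le (hz k p)) hV
  have hsq : ∀ᵐ ω ∂μ, ∀ p : Nat.Primes, f p ω ^ 2 = 1 := ae_all_iff.2 hfam.sq_eq_one
  filter_upwards [hunb, hsq, ae_all_iff.2 hfam.ae_abs_eq_one] with ω hω hsqω habs hbdd
  refine hω ?_
  obtain ⟨B, hB⟩ := hbdd
  refine ⟨Real.log B - Real.log c / 2, ?_⟩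
  rintro _ ⟨k, rfl⟩
  have hBk : ‖eulerProd f ω (N k) (s k)‖ ≤ B := hB ⟨k, rfl⟩
  have hfac : ∀ p : Nat.Primes, 0 < ‖1 + z k p * (f p ω : ℂ)‖ := fun p => by
    refine norm_one_add_pos ?_
    rw [norm_mul, Complex.norm_real, Real.norm_eq_abs, habs p, mul_one]
    exact hz1 k p
  have hnorm : ‖eulerProd f ω (N k) (s k)‖ = ∏ p ∈ J k, ‖1 + z k p * (f p ω : ℂ)‖ := by
    rw [eulerProd, norm_prod, primesLE_prod]
  have hpos : 0 < ‖eulerProd f ω (N k) (s k)‖ := by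
    rw [hnorm]
    exact Finset.prod_pos fun p _ => hfac p
  have hlog : Real.log ‖eulerProd f ω (N k) (s k)‖ =
      Real.log (∏ p ∈ J k, ‖1 - z k p ^ 2‖) / 2 + ∑ p ∈ J k, halfLogRatio (z k p) * f p ω := by
    rw [hnorm, Real.log_prod fun p _ => (hfac p).ne', Real.log_prod, Finset.sum_div,
      ← Finset.sum_add_distrib]
    · exact Finset.sum_congr rfl fun p _ => log_norm_one_add_mul (hz1 k p) (hsqω p)
    · intro p _
      rw [norm_one_sub_sq]
      exact (mul_pos (norm_one_add_pos (hz1 k p)) (norm_one_sub_pos (hz1 k p))).ne'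
  have h1 := Real.log_le_log hpos hBk
  have h2 := Real.log_le_log hc (hlow k)
  simp only
  linarith

end IsRademacherRMF

/-! ### Consequences of a one-sided bound at a fixed outcome -/

section Deterministic

variable {Ω : Type*} {f : ℕ → Ω → ℝ} {ω : Ω}

lemma measurable_partialSum (f : ℕ → Ω → ℝ) (ω : Ω) : Measurable (partialSum f ω) :=
  (measurable_from_nat (f := fun n : ℕ => ∑ k ∈ Finset.Icc 1 n, f k ω)).comp Nat.measurable_floor

lemma abs_partialSum_le {x : ℝ} {N : ℕ} (hx : x ≤ N) :
    |partialSum f ω x| ≤ ∑ n ∈ Finset.Icc 1 N, |f n ω| := by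
  refine (Finset.abs_sum_le_sum_abs _ _).trans ?_
  refine Finset.sum_le_sum_of_subset_of_nonneg (Finset.Icc_subset_Icc_right ?_)
    fun n _ _ => abs_nonneg _
  exact (Nat.floor_mono hx).trans (Nat.floor_natCast N).le

lemma integrableOn_partialSum (f : ℕ → Ω → ℝ) (ω : Ω) (N : ℕ) :
    IntegrableOn (partialSum f ω) (Set.Ioc 1 (N : ℝ)) := by
  refine Measure.integrableOn_of_bounded (M := ∑ n ∈ Finset.Icc 1 N, |f n ω|)
    measure_Ioc_lt_top.ne (measurable_partialSum f ω).aestronglyMeasurable ?_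
  filter_upwards [ae_restrict_mem measurableSet_Ioc] with x hx
  exact abs_partialSum_le hx.2

lemma integrableOn_partialSum_mul_rpow (f : ℕ → Ω → ℝ) (ω : Ω) (N : ℕ) (σ : ℝ) (hσ : 0 ≤ σ) :
    IntegrableOn (fun t => partialSum f ω t * t ^ (-σ - 1)) (Set.Ioc 1 (N : ℝ)) := by
  have hm : Measurable fun t : ℝ => partialSum f ω t * t ^ (-σ - 1) :=
    (measurable_partialSum f ω).mul (measurable_id.pow_const _)
  refine Integrable.mono (integrableOn_partialSum f ω N) hm.aestronglyMeasurable ?_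
  filter_upwards [ae_restrict_mem measurableSet_Ioc] with x hx
  rw [norm_mul, Real.norm_of_nonneg (Real.rpow_nonneg (by linarith [hx.1]) _)]
  exact mul_le_of_le_one_right (norm_nonneg _)
    (Real.rpow_le_one_of_one_le_of_nonpos hx.1.le (by linarith))

/-- One-sided bounds for the partial sums up to a perturbation `lam` control the absolute Mellin
transform by the Mellin transform itself. -/
lemma exists_integral_abs_le {lam : ℝ → ℝ} {η : ℝ}
    (hlam : IntegrableOn (fun u : ℝ => |lam u| / u ^ (3 / 2 : ℝ)) (Set.Ici 1))
    (hη : |η| = 1)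
    (h : ∀ᶠ x in atTop, |partialSum f ω x| ≤ η * partialSum f ω x + 2 * |lam x|) :
    ∃ B : ℝ, ∀ (σ : ℝ) (N : ℕ), 1 / 2 < σ →
      ∫ t in Set.Ioc (1 : ℝ) N, |partialSum f ω t * t ^ (-σ - 1)| ≤
        |∫ t in Set.Ioc (1 : ℝ) N, partialSum f ω t * t ^ (-σ - 1)| + B := by
  obtain ⟨x₀, hx₀⟩ := eventually_atTop.1 h
  obtain ⟨n₀, hn₀⟩ := exists_nat_ge x₀
  -- `G` absorbs the initial range `t ≤ n₀`, where the one-sided bound may fail: there `|Φ| ≤ η Φ +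
  -- 2|Φ|` always holds.
  set G : ℝ → ℝ := (Set.Ioc (1 : ℝ) n₀).indicator fun t => 2 * |partialSum f ω t| with hG
  have hGint : Integrable G :=
    (integrable_indicator_iff measurableSet_Ioc).2
      ((integrableOn_partialSum f ω n₀).abs.const_mul 2)
  have hG0 : ∀ t, 0 ≤ G t := fun t => Set.indicator_nonneg (fun _ _ => by positivity) t
  set L : ℝ → ℝ := fun u => |lam u| / u ^ (3 / 2 : ℝ) with hL
  refine ⟨2 * (∫ u in Set.Ici (1 : ℝ), L u) + ∫ t, G t, fun σ N hσ => ?_⟩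
  set Φ : ℝ → ℝ := fun t => partialSum f ω t * t ^ (-σ - 1) with hΦ
  have hΦint : IntegrableOn Φ (Set.Ioc (1 : ℝ) N) :=
    integrableOn_partialSum_mul_rpow f ω N σ (by linarith)
  have hsub : Set.Ioc (1 : ℝ) N ⊆ Set.Ici 1 := fun t ht => ht.1.le
  have hLint : IntegrableOn L (Set.Ioc (1 : ℝ) N) := hlam.mono_set hsub
  have hpt : ∀ t ∈ Set.Ioc (1 : ℝ) N, |Φ t| ≤ η * Φ t + 2 * L t + G t := fun t ht => by
    have ht0 : 0 < t := by linarith [ht.1]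
    have hr : 0 < t ^ (-σ - 1) := Real.rpow_pos_of_pos ht0 _
    have hr1 : t ^ (-σ - 1) ≤ 1 := Real.rpow_le_one_of_one_le_of_nonpos ht.1.le (by linarith)
    have hL0 : 0 ≤ L t := div_nonneg (abs_nonneg _) (Real.rpow_nonneg ht0.le _)
    have habs : |Φ t| = |partialSum f ω t| * t ^ (-σ - 1) := by
      rw [hΦ]; simp only; rw [abs_mul, abs_of_pos hr]
    by_cases htn : t ≤ n₀
    · have e : G t = 2 * |partialSum f ω t| := Set.indicator_of_mem (s := Set.Ioc (1 : ℝ) n₀) ⟨ht.1, htn⟩ _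
      have h1 : |Φ t| ≤ |partialSum f ω t| := by
        rw [habs]; exact mul_le_of_le_one_right (abs_nonneg _) hr1
      have h2 : -|Φ t| ≤ η * Φ t := by
        have := neg_abs_le (η * Φ t)
        rwa [abs_mul, hη, one_mul] at this
      rw [e]
      linarith
    · have h1 := hx₀ t (by linarith)
      have h2 : |lam t| * t ^ (-σ - 1) ≤ L t := by
        rw [hL]
        simp only
        rw [div_eq_mul_inv, ← Real.rpow_neg ht0.le]
        exact mul_le_mul_of_nonneg_left
          (Real.rpow_le_rpow_of_exponent_le ht.1.le (by linarith)) (abs_nonneg _)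
      have h3 := mul_le_mul_of_nonneg_right h1 hr.le
      rw [habs]
      have e : η * Φ t = η * partialSum f ω t * t ^ (-σ - 1) := by rw [hΦ]; ring
      rw [e]
      linarith [hG0 t]
  have hi1 := hΦint.const_mul η
  have hi2 := hLint.const_mul 2
  have hi3 : IntegrableOn G (Set.Ioc (1 : ℝ) N) := hGint.integrableOn
  have hmono := setIntegral_mono_on hΦint.abs ((hi1.fun_add hi2).fun_add hi3)
    measurableSet_Ioc hpt
  rw [integral_add (hi1.fun_add hi2) hi3, integral_add hi1 hi2, integral_const_mul,
    integral_const_mul] at hmono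
  have h1 : η * ∫ t in Set.Ioc (1 : ℝ) N, Φ t ≤ |∫ t in Set.Ioc (1 : ℝ) N, Φ t| := by
    refine (le_abs_self _).trans ?_
    rw [abs_mul, hη, one_mul]
  have h2 : ∫ t in Set.Ioc (1 : ℝ) N, L t ≤ ∫ t in Set.Ici (1 : ℝ), L t := by
    refine setIntegral_mono_set hlam ?_ hsub.eventuallyLE
    filter_upwards [ae_restrict_mem measurableSet_Ici] with t ht
    have : (1 : ℝ) ≤ t := ht
    exact div_nonneg (abs_nonneg _) (Real.rpow_nonneg (by linarith) _)
  have h3 : ∫ t in Set.Ioc (1 : ℝ) N, G t ≤ ∫ t, G t :=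
    setIntegral_le_integral hGint (ae_of_all _ hG0)
  linarith

open scoped Topology in
/-- If the Euler products tend to zero on the real axis but are unbounded on a vertical
translate, then the partial sums cannot have a one-sided bound up to `lam`. -/
lemma not_eventually_abs_partialSum_le {σ : ℕ → ℝ} {N : ℕ → ℕ}
    (hσ : ∀ k, 1 / 2 < σ k) (hσ1 : ∀ k, σ k < 1)
    (hreal : Tendsto (fun k => ‖mellinError f ω (N k) (σ k)‖) atTop (𝓝 0))
    (hcomplex : Tendsto (fun k => ‖mellinError f ω (N k) (σ k + Complex.I)‖) atTop (𝓝 0))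
    (hzero : Tendsto (fun k => ‖eulerProd f ω (N k) (σ k)‖) atTop (𝓝 0))
    (hunb : ¬ BddAbove (Set.range fun k => ‖eulerProd f ω (N k) (σ k + Complex.I)‖))
    {lam : ℝ → ℝ} {η : ℝ}
    (hlam : IntegrableOn (fun u : ℝ => |lam u| / u ^ (3 / 2 : ℝ)) (Set.Ici 1))
    (hη : |η| = 1) :
    ¬ ∀ᶠ x in atTop, |partialSum f ω x| ≤ η * partialSum f ω x + 2 * |lam x| := by
  intro h
  obtain ⟨B, hB⟩ := exists_integral_abs_le hlam hη h
  obtain ⟨b₁, hb₁⟩ := hreal.bddAbove_range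
  obtain ⟨b₂, hb₂⟩ := hcomplex.bddAbove_range
  obtain ⟨b₃, hb₃⟩ := hzero.bddAbove_range
  refine hunb ⟨b₂ + 2 * (2 * (b₁ + b₃) + B), ?_⟩
  rintro _ ⟨k, rfl⟩
  have h1 : ‖mellinError f ω (N k) (σ k)‖ ≤ b₁ := hb₁ ⟨k, rfl⟩
  have h2 : ‖mellinError f ω (N k) (σ k + Complex.I)‖ ≤ b₂ := hb₂ ⟨k, rfl⟩
  have h3 : ‖eulerProd f ω (N k) (σ k)‖ ≤ b₃ := hb₃ ⟨k, rfl⟩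
  have hσk := hσ k
  set I₁ : ℝ := ∫ t in Set.Ioc (1 : ℝ) (N k), partialSum f ω t * t ^ (-σ k - 1) with hI₁
  have e1 : ∫ t in Set.Ioc (1 : ℝ) (N k), (partialSum f ω t : ℂ) * (t : ℂ) ^ (-(σ k : ℂ) - 1) =
      (I₁ : ℂ) := by
    rw [hI₁, ← integral_complex_ofReal]
    refine setIntegral_congr_fun measurableSet_Ioc fun t ht => ?_
    have ht0 : 0 ≤ t := by linarith [ht.1]
    push_cast
    rw [Complex.ofReal_cpow ht0]
    push_cast
    rfl
  -- The factor `2` comes from dividing by `σ > 1/2`.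
  have h4 : |I₁| ≤ 2 * (b₁ + b₃) := by
    have e : (σ k : ℂ) * (I₁ : ℂ) =
        mellinError f ω (N k) (σ k) + eulerProd f ω (N k) (σ k) := by
      rw [mellinError, e1]; ring
    have := (congrArg norm e).le.trans (norm_add_le _ _)
    rw [norm_mul, Complex.norm_real, Complex.norm_real, Real.norm_of_nonneg (by linarith),
      Real.norm_eq_abs] at this
    nlinarith [abs_nonneg I₁]
  have h5 : ‖∫ t in Set.Ioc (1 : ℝ) (N k),
      (partialSum f ω t : ℂ) * (t : ℂ) ^ (-((σ k : ℂ) + Complex.I) - 1)‖ ≤ 2 * (b₁ + b₃) + B := by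
    refine (norm_integral_le_integral_norm _).trans ?_
    -- Absolute values remove the oscillation `t^{-i}`, so the bound found on the real axis applies
    -- at `σ + i`.
    have e : ∫ t in Set.Ioc (1 : ℝ) (N k),
        ‖(partialSum f ω t : ℂ) * (t : ℂ) ^ (-((σ k : ℂ) + Complex.I) - 1)‖ =
        ∫ t in Set.Ioc (1 : ℝ) (N k), |partialSum f ω t * t ^ (-σ k - 1)| := by
      refine setIntegral_congr_fun measurableSet_Ioc fun t ht => ?_
      have ht0 : 0 < t := by linarith [ht.1]
      rw [norm_mul, Complex.norm_real, Complex.norm_cpow_eq_rpow_re_of_pos ht0, abs_mul,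
        abs_of_pos (Real.rpow_pos_of_pos ht0 _), Real.norm_eq_abs]
      simp
    rw [e]
    linarith [hB (σ k) (N k) hσk]
  have h6 : ‖(σ k : ℂ) + Complex.I‖ ≤ 2 := by
    refine (norm_add_le _ _).trans ?_
    rw [Complex.norm_real, Complex.norm_I, Real.norm_of_nonneg (by linarith)]
    linarith [hσ1 k]
  have e2 : eulerProd f ω (N k) (σ k + Complex.I) = ((σ k : ℂ) + Complex.I) *
      (∫ t in Set.Ioc (1 : ℝ) (N k),
        (partialSum f ω t : ℂ) * (t : ℂ) ^ (-((σ k : ℂ) + Complex.I) - 1)) -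
      mellinError f ω (N k) (σ k + Complex.I) := by
    rw [mellinError]; ring
  simp only
  rw [e2]
  refine (norm_sub_le _ _).trans ?_
  rw [norm_mul]
  have := mul_le_mul h6 h5 (norm_nonneg _) (by norm_num)
  linarith

/-- The comparison function `√x / (log x (log log x)²)`, cut off near the origin, is admissible. -/
lemma integrableOn_comparison :
    IntegrableOn (fun u : ℝ => |(Set.Ioi (16 : ℝ)).indicator (fun x : ℝ =>
      Real.sqrt x / (Real.log x * (Real.log (Real.log x)) ^ 2)) u| / u ^ (3 / 2 : ℝ))
      (Set.Ici 1) := by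
  -- The cut-off `16` only serves to make `log x > 1`, so that `log log x > 0`.
  have h16 : (1 : ℝ) < Real.log 16 := by
    have : Real.log 16 = 4 * Real.log 2 := by
      rw [show (16 : ℝ) = 2 ^ 4 by norm_num, Real.log_pow]; norm_num
    rw [this]; linarith [Real.log_two_gt_d9]
  have hlog : ∀ x ∈ Set.Ici (16 : ℝ), 1 < Real.log x := fun x hx =>
    h16.trans_le (Real.log_le_log (by norm_num) hx)
  have hderiv : ∀ x ∈ Set.Ici (16 : ℝ), HasDerivAt (fun x => -(Real.log (Real.log x))⁻¹)
      (1 / (x * (Real.log x * (Real.log (Real.log x)) ^ 2))) x := fun x hx => by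
    have hx0 : x ≠ 0 := by
      have : (16 : ℝ) ≤ x := hx
      linarith
    have h1 := hlog x hx
    have h2 : 0 < Real.log (Real.log x) := Real.log_pos h1
    have h3 := (((Real.hasDerivAt_log hx0).log (by linarith)).fun_inv h2.ne').fun_neg
    convert! h3 using 1
    field_simp
  have hint : IntegrableOn (fun x : ℝ => 1 / (x * (Real.log x * (Real.log (Real.log x)) ^ 2)))
      (Set.Ioi 16) := by
    refine integrableOn_Ioi_deriv_of_nonneg' (l := -0) hderiv (fun x hx => ?_) ?_
    · have h1 := hlog x (Set.Ioi_subset_Ici_self hx)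
      have : (16 : ℝ) < x := hx
      positivity
    · exact ((Real.tendsto_log_atTop.comp Real.tendsto_log_atTop).inv_tendsto_atTop).neg
  have hind := (hint.integrable_indicator measurableSet_Ioi).integrableOn (s := Set.Ici (1 : ℝ))
  refine hind.congr_fun (fun x hx => ?_) measurableSet_Ici
  by_cases hx16 : x ∈ Set.Ioi (16 : ℝ)
  · simp only [Set.indicator_of_mem hx16]
    have h1 := hlog x (Set.Ioi_subset_Ici_self hx16)
    have hx0 : 0 < x := by
      have : (16 : ℝ) < x := hx16
      linarith
    have h2 : 0 < Real.log (Real.log x) := Real.log_pos h1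
    rw [abs_of_nonneg (by positivity), show (3 / 2 : ℝ) = 1 + 1 / 2 by norm_num,
      Real.rpow_add hx0, Real.rpow_one, ← Real.sqrt_eq_rpow]
    have := Real.sqrt_pos.2 hx0
    field_simp
  · simp [Set.indicator_of_notMem hx16]

end Deterministic

/-- The exceptional null set comes only from the Euler products and Mellin errors, so a single one
serves every `lam`. A sign condition on `M + lam` enters as `|M| ≤ η M + 2|lam|`, with `η = 1` or `η
= -1`. -/
lemma IsRademacherRMF.ae_forall_changesSign {Ω : Type*} [MeasurableSpace Ω] {μ : Measure Ω}
    [IsProbabilityMeasure μ] {f : ℕ → Ω → ℝ} (hf : IsRademacherRMF μ f) :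
    ∀ᵐ ω ∂μ, ∀ lam : ℝ → ℝ,
      IntegrableOn (fun u : ℝ => |lam u| / u ^ (3 / 2 : ℝ)) (Set.Ici 1) volume →
        ChangesSignInfinitelyOften (fun x => partialSum f ω x + lam x) := by
  obtain ⟨c, C, hc, h⟩ := exists_abscissa_cutoff
  choose σ N hσ hσ1 hN htail hsum hlow hupp using h
  have hre : ∀ k, ((σ k : ℂ) + Complex.I).re = σ k := fun k => by simp
  have hre' : ∀ k, (σ k : ℂ).re = σ k := fun k => Complex.ofReal_re _
  have a1 := hf.ae_tendsto_mellinError (s := fun k => (σ k : ℂ)) (N := N)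
    (fun k => by rw [hre']; linarith [hσ k]) hN (fun k => by rw [hre']; exact htail k)
  have a2 := hf.ae_tendsto_mellinError (s := fun k => (σ k : ℂ) + Complex.I) (N := N)
    (fun k => by rw [hre]; linarith [hσ k]) hN (fun k => by rw [hre]; exact htail k)
  have a3 := hf.ae_tendsto_eulerProd_real hσ hsum
  have a4 := hf.ae_not_bddAbove_norm_eulerProd (s := fun k => (σ k : ℂ) + Complex.I) (N := N)
    (fun k => by rw [hre]; exact hσ k) hc (fun k => by rw [hre]; exact hsum k) hlow hupp
  filter_upwards [a1, a2, a3, a4] with ω h1 h2 h3 h4 lam hlam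
  constructor
  · intro hev
    refine not_eventually_abs_partialSum_le hσ hσ1 h1 h2 h3 h4 hlam (η := 1) (by simp) ?_
    filter_upwards [hev] with x hx
    rcases abs_cases (partialSum f ω x) with h | h <;> rcases abs_cases (lam x) with h' | h' <;>
      linarith
  · intro hev
    refine not_eventually_abs_partialSum_le hσ hσ1 h1 h2 h3 h4 hlam (η := -1) (by simp) ?_
    filter_upwards [hev] with x hx
    rcases abs_cases (partialSum f ω x) with h | h <;> rcases abs_cases (lam x) with h' | h' <;>
      linarith

theorem theorem2 {Ω : Type*} [MeasurableSpace Ω] (μ : Measure Ω) [IsProbabilityMeasure μ]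
    (f : ℕ → Ω → ℝ) (hf : IsRademacherRMF μ f) :
    (∀ lam : ℝ → ℝ,
      IntegrableOn (fun u : ℝ => |lam u| / u ^ (3 / 2 : ℝ)) (Set.Ici 1) volume →
        ∀ᵐ ω ∂μ, ChangesSignInfinitelyOften (fun x => partialSum f ω x + lam x)) ∧
    (∀ᵐ ω ∂μ, IsOmegaPlusMinus (partialSum f ω)
      (fun x => Real.sqrt x / (Real.log x * (Real.log (Real.log x)) ^ 2))) := by
  refine ⟨fun lam hlam => hf.ae_forall_changesSign.mono fun ω h => h lam hlam, ?_⟩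
  set g : ℝ → ℝ := fun x => Real.sqrt x / (Real.log x * (Real.log (Real.log x)) ^ 2) with hg
  have hind : ∀ᶠ x in atTop, (Set.Ioi (16 : ℝ)).indicator g x = g x :=
    (eventually_gt_atTop 16).mono fun x hx => Set.indicator_of_mem hx g
  filter_upwards [hf.ae_forall_changesSign] with ω h
  refine ⟨⟨1, one_pos, ?_⟩, ⟨1, one_pos, ?_⟩⟩
  -- Failure of `M - g ≤ 0` for all large `x` gives `M > g` for arbitrarily large `x`, so the
  -- constant `1` suffices; the other sign uses `M + g ≥ 0`.
  · have := (h (fun x => -(Set.Ioi (16 : ℝ)).indicator g x)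
      (by simpa only [abs_neg] using integrableOn_comparison)).2
    refine ((not_eventually.1 this).and_eventually hind).mono fun x hx => ?_
    rw [← hx.2]
    linarith [not_le.1 hx.1]
  · have := (h ((Set.Ioi (16 : ℝ)).indicator g) integrableOn_comparison).1
    refine ((not_eventually.1 this).and_eventually hind).mono fun x hx => ?_
    rw [← hx.2]
    linarith [not_le.1 hx.1]
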